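/- **Setting.** Let $\mathfrak S_N$ act on $(\mathbb C^2)^{\otimes N}$ by permuting the factors and $SL(2,\mathbb C)$ by $g\mapsto g^{\otimes N}$. A Schur–Weyl embedding is an isometric linear map $(\mathbb C^2)^{\otimes N}\hookrightarrow(\mathbb C^2)^{\otimes(N+2)}$ that commutes with both $\mathfrak S_N$ (the permutations of the first $N$ factors) and $SL(2,\mathbb C)$. For a two-row Young diagram $\lambda=(k+n,n)$ let $\pi_\lambda$ be the irreducible representation of $\mathfrak S_{k+2n}$ in Young's orthogonal form, with orthonormal basis the standard Young tableaux of shape $\lambda$, and let $M_{k+1}$ be the irreducible $SL(2,\mathbb C)$-module of dimension $k+1$ (the symmetric tensors in $(\mathbb C^2)^{\otimes k}$). Put $N=k+2n$ and $\mu=(k+n+1,n+1)$. For a tableau $t$ of shape $\lambda$ let $t\,t_{21}$ (resp. $t\,t_{12}$) be the tableau of shape $\mu$ obtained by putting $N+1$ into the second and $N+2$ into the first row (resp. $N+1$ into the first and $N+2$ into the second row); if $k=0$, then $t\,t_{21}$ does not exist and is read as $0$. A unit vector $h=p\,t_{21}+q\,t_{12}$ ($p,q\in\mathbb C$, $|p|^2+|q|^2=1$)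 gives the map $i_h:\pi_\lambda\to\pi_\mu$, $t\mapsto p\,(t\,t_{21})+q\,(t\,t_{12})$. A linear map $\iota:(\mathbb C^2)^{\otimes N}\to(\mathbb C^2)^{\otimes(N+2)}$ has parameter $h$ in the component $k$ if there are isometric $\mathfrak S\times SL(2,\mathbb C)$-equivariant embeddings $J:\pi_\lambda\otimes M_{k+1}\hookrightarrow(\mathbb C^2)^{\otimes N}$ and $J':\pi_\mu\otimes M_{k+1}\hookrightarrow(\mathbb C^2)^{\otimes(N+2)}$ with $\iota\circ J=J'\circ(i_h\otimes\mathrm{id})$. As $J,J'$ are unique up to phases, $h$ matters only up to a phase. For a tableau $t$ with $N$ cells whose diagram has at most two rows and row difference $\lambda_1-\lambda_2=k$, and a sequence $h=(h_0,h_1,\dots)$ of such unit vectors, $h_j=p_jt_{21}+q_jt_{12}$, let $\mu_t^h$ be the distribution on infinite (two-row) Young tableaux of the random walk that starts from $t$ and passes from level $n'$ to level $n'+2$ ($n'=N,N+2,\dots$) by independent steps, by $t_{21}$ with probability $|p_j|^2$ and by $t_{12}$ with probability $|q_j|^2$, where $j=(n'-k)/2$. **Proposition.** Let $v_0=\frac1{\sqrt2}(e_1\otimes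 e_2-e_2\otimes e_1)$. For every $N\ge0$ the tensor embedding $v\mapsto v\otimes v_0$ is a Schur–Weyl embedding $(\mathbb C^2)^{\otimes N}\hookrightarrow(\mathbb C^2)^{\otimes(N+2)}$, and a map $v\mapsto v\otimes w$ with $w\in(\mathbb C^2)^{\otimes2}$ is a Schur–Weyl embedding if and only if $w=c\,v_0$ with $|c|=1$. Let $k\ge0$ and $r=k+1$. 1. For every $n\ge0$, a unit vector $p\,t_{21}+q\,t_{12}$ is a parameter of the tensor embedding of $(\mathbb C^2)^{\otimes(k+2n)}$ in the component $k$ if and only if, up to a common phase, $$p=-\sqrt{\frac{r-1}{2r}},\qquad q=\sqrt{\frac{r+1}{2r}};$$ with the normalization $q\ge0$ these equalities hold exactly. 2. Consequently, if $h=(h_0,h_1,\dots)$ is such that each $h_n$ is a parameter, in the component $k$, of the tensor embedding of $(\mathbb C^2)^{\otimes(k+2n)}$, then $$|p_j|^2=\alpha=\frac{r-1}{2r},\qquad |q_j|^2=\beta=\frac{r+1}{2r}\qquad\text{for all } j,$$ and for every finite tableau $t$ with at most two rows and row difference $k$ the measure $\mu_t^h$ is a Bernoulli probability measure with weights $\alpha,\beta$: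 for every sequence of $M\ge0$ double steps, of which $a$ are $t_{21}$ and $M-a$ are $t_{12}$, the probability that the walk starts with $t$ followed by these steps is $\alpha^a\beta^{M-a}$. -/

import Mathlib

open MeasureTheory

noncomputable section

namespace SchurWeyl

/-! ## The tensor spaces `(ℂ²)^{⊗N}` -/

/-- `(ℂ²)^{⊗N}` with its standard inner product, in the orthonormal basis
`e_{x 0} ⊗ ⋯ ⊗ e_{x (N-1)}`, `x : Fin N → Fin 2`. -/
abbrev Tens (N : ℕ) : Type := EuclideanSpace ℂ (Fin N → Fin 2)

/-- `v ⊗ w` as an element of `(ℂ²)^{⊗N} ⊗ (ℂ²)^{⊗M} = (ℂ²)^{⊗(N+M)}`. -/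
def tmul {N M : ℕ} (v : Tens N) (w : Tens M) : Tens (N + M) :=
  WithLp.toLp 2 fun x => v (fun i => x (Fin.castAdd M i)) * w (fun i => x (Fin.natAdd N i))

/-- The linear map `v ↦ v ⊗ w`. -/
def tmulRight (N : ℕ) {M : ℕ} (w : Tens M) : Tens N →ₗ[ℂ] Tens (N + M) where
  toFun v := tmul v w
  map_add' u v := by ext x; simp [tmul, add_mul]
  map_smul' c v := by ext x; simp [tmul, mul_assoc]

/-- The action of `𝔖_N` on `(ℂ²)^{⊗N}` by permutations of the factors:
the `i`-th factor is moved to the place `σ i`. -/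
def permRep (N : ℕ) : Representation ℂ (Equiv.Perm (Fin N)) (Tens N) where
  toFun σ :=
    { toFun := fun v => WithLp.toLp 2 fun x => v (x ∘ σ)
      map_add' := fun u v => by ext x; simp
      map_smul' := fun c v => by ext x; simp }
  map_one' := by ext v x; simp
  map_mul' σ τ := by ext v x; simp [Function.comp_assoc]

/-- The action of `SL(2,ℂ)` on `(ℂ²)^{⊗N}`, `g ↦ g ⊗ ⋯ ⊗ g`. -/
def slRep (N : ℕ) : Representation ℂ (Matrix.SpecialLinearGroup (Fin 2) ℂ) (Tens N) where
  toFun g :=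
    { toFun := fun v => WithLp.toLp 2 fun x =>
        ∑ y : Fin N → Fin 2, (∏ i, (g : Matrix (Fin 2) (Fin 2) ℂ) (x i) (y i)) * v y
      map_add' := fun u v => by ext x; simp [mul_add, Finset.sum_add_distrib]
      map_smul' := fun c v => by ext x; simp [Finset.mul_sum, mul_left_comm] }
  map_one' := by
    refine LinearMap.ext fun v => ?_
    ext x
    have h : ∀ y : Fin N → Fin 2,
        (∏ i, (1 : Matrix (Fin 2) (Fin 2) ℂ) (x i) (y i)) = if x = y then 1 else 0 := by
      intro y
      split_ifs with hxy
      · subst hxy; simp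
      · obtain ⟨i, hi⟩ := Function.ne_iff.mp hxy
        exact Finset.prod_eq_zero (Finset.mem_univ i) (Matrix.one_apply_ne hi)
    simp [h]
  map_mul' g h := by
    refine LinearMap.ext fun v => ?_
    ext x
    simp only [LinearMap.coe_mk, AddHom.coe_mk, Module.End.mul_apply,
      Matrix.SpecialLinearGroup.coe_mul, Matrix.mul_apply, Finset.prod_univ_sum,
      Fintype.piFinset_univ, Finset.sum_mul, Finset.mul_sum, Finset.prod_mul_distrib]
    rw [Finset.sum_comm]
    simp only [mul_assoc]

/-- The standard embedding `𝔖_N ⊂ 𝔖_{N+M}` (permutations of the first `N` places). -/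
def permIncl {N : ℕ} (M : ℕ) (σ : Equiv.Perm (Fin N)) : Equiv.Perm (Fin (N + M)) :=
  finSumFinEquiv.permCongr (Equiv.sumCongr σ (Equiv.refl (Fin M)))

/-- Schur–Weyl embeddings `(ℂ²)^{⊗N} ↪ (ℂ²)^{⊗(N+2)}`: isometric linear maps that commute with
the actions of `𝔖_N` and `SL(2,ℂ)`. -/
structure IsSchurWeylEmbedding {N : ℕ} (ι : Tens N →ₗ[ℂ] Tens (N + 2)) : Prop where
  isometry : ∀ v, ‖ι v‖ = ‖v‖
  perm : ∀ (σ : Equiv.Perm (Fin N)) v, ι (permRep N σ v) = permRep (N + 2) (permIncl 2 σ) (ι v)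
  sl : ∀ (g : Matrix.SpecialLinearGroup (Fin 2) ℂ) v, ι (slRep N g v) = slRep (N + 2) g (ι v)

/-- The singlet `(e₁ ⊗ e₂ - e₂ ⊗ e₁) / √2`. -/
def singlet : Tens 2 :=
  (((1 / √2 : ℝ)) : ℂ) • (EuclideanSpace.single ![0, 1] 1 - EuclideanSpace.single ![1, 0] 1)

/-- The tensor Schur–Weyl embedding `v ↦ v ⊗ v₀`, `v₀` the singlet. -/
def tensorEmbedding (N : ℕ) : Tens N →ₗ[ℂ] Tens (N + 2) := tmulRight N singlet

/-! ## Two-row Young tableaux -/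

/-- The number of the first `m` letters of `f` that are equal to `a`. -/
def countBelow {N : ℕ} (f : Fin N → Fin 2) (a : Fin 2) (m : ℕ) : ℕ :=
  (Finset.univ.filter fun j : Fin N => (j : ℕ) < m ∧ f j = a).card

/-- A Young tableau with `N` cells and at most two rows, i.e. a path of length `N` in the Young
graph through diagrams with at most two rows, is encoded by the function that tells in which row
(`0` is the first, `1` the second) the `(i+1)`-st cell is put; at each moment the second row is not
longer than the first. The final diagram `(λ₁, λ₂)` is to satisfy `λ₁ - λ₂ = k`. -/
def IsTableau {N : ℕ} (k : ℕ) (f : Fin N → Fin 2) : Prop :=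
  (∀ m ≤ N, countBelow f 1 m ≤ countBelow f 0 m) ∧ countBelow f 0 N = countBelow f 1 N + k

/-- The set `𝒯_N(λ)` of Young tableaux, `λ` the two-row diagram with `N` cells and
`λ₁ - λ₂ = k`. -/
abbrev Tableau (N k : ℕ) : Type := {f : Fin N → Fin 2 // IsTableau k f}

instance (N k : ℕ) : Fintype (Tableau N k) := Fintype.ofFinite _

/-- The content (column minus row) of the cell that contains `i + 1`. -/
def content {N : ℕ} (f : Fin N → Fin 2) (i : Fin N) : ℤ :=
  (countBelow f (f i) i : ℤ) - ((f i : ℕ) : ℤ)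

/-! ## The irreducible representations -/

/-- The space of the irreducible representation `π_λ` of `𝔖_N`, with the orthonormal basis
of tableaux. -/
abbrev YoungSpace (N k : ℕ) : Type := EuclideanSpace ℂ (Tableau N k)

open Classical in
/-- The basis vector of the tableau `f`, and `0` if `f` is not a tableau of the given shape. -/
def youngVec {N k : ℕ} (f : Fin N → Fin 2) : YoungSpace N k :=
  if h : IsTableau k f then EuclideanSpace.single ⟨f, h⟩ 1 else 0

/-- Young's orthogonal form: with the axial distance `d = c_{i+1} - c_i` in `t`, the Coxeter
transposition `s` of the places `i` and `i + 1` sends `t` to `d⁻¹ t + √(1 - d⁻²) (s t)`. -/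
def youngGen {N k : ℕ} (i : ℕ) (hi : i + 1 < N) : YoungSpace N k →ₗ[ℂ] YoungSpace N k :=
  (EuclideanSpace.basisFun (Tableau N k) ℂ).toBasis.constr ℂ fun t =>
    let a : Fin N := ⟨i, Nat.lt_of_succ_lt hi⟩
    let b : Fin N := ⟨i + 1, hi⟩
    let d : ℝ := ((content t.1 b - content t.1 a : ℤ) : ℝ)
    ((d⁻¹ : ℝ) : ℂ) • youngVec t.1 + ((√(1 - (d⁻¹) ^ 2) : ℝ) : ℂ) • youngVec (t.1 ∘ Equiv.swap a b)

/-- The space `M_{k+1}` of the irreducible representation of `SL(2,ℂ)` of dimension `k + 1`: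
the symmetric tensors in `(ℂ²)^{⊗k}`. -/
def symTens (k : ℕ) : Submodule ℂ (Tens k) where
  carrier := {m | ∀ σ, permRep k σ m = m}
  add_mem' ha hb σ := by rw [map_add, ha σ, hb σ]
  zero_mem' σ := map_zero _
  smul_mem' c m hm σ := by rw [map_smul, hm σ]

theorem permRep_slRep {N : ℕ} (σ : Equiv.Perm (Fin N)) (g : Matrix.SpecialLinearGroup (Fin 2) ℂ)
    (v : Tens N) : permRep N σ (slRep N g v) = slRep N g (permRep N σ v) := by
  ext x
  simp only [permRep, slRep, MonoidHom.coe_mk, OneHom.coe_mk, LinearMap.coe_mk, AddHom.coe_mk,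
    Function.comp_apply]
  refine (Fintype.sum_equiv (σ.arrowCongr (Equiv.refl (Fin 2))).symm _ _ fun y => ?_).symm
  have h : (σ.arrowCongr (Equiv.refl (Fin 2))).symm y = y ∘ σ := by
    ext i; simp [Equiv.arrowCongr]
  rw [h]
  congr 1
  exact (Equiv.prod_comp σ fun i => (g : Matrix (Fin 2) (Fin 2) ℂ) (x i) (y i)).symm

/-- The action of `g ∈ SL(2,ℂ)` on `M_{k+1}`. -/
def symAct (k : ℕ) (g : Matrix.SpecialLinearGroup (Fin 2) ℂ) : symTens k →ₗ[ℂ] symTens k :=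
  (slRep k g).restrict fun m hm σ => by rw [permRep_slRep, hm σ]

/-- `J` describes an isometric embedding `π_λ ⊗ M_{k+1} ↪ (ℂ²)^{⊗N}`, `u ⊗ m ↦ J u m`,
equivariant with respect to `𝔖_N` (acting in `π_λ` by Young's orthogonal form) and `SL(2,ℂ)`.
By the Schur–Weyl duality, it is an identification of `π_λ ⊗ M_{k+1}` with the corresponding
primary component. -/
structure IsComponent {N k : ℕ} (J : YoungSpace N k →ₗ[ℂ] symTens k →ₗ[ℂ] Tens N) : Prop where
  isometry : ∀ u u' m m', inner ℂ (J u m) (J u' m') = inner ℂ u u' * inner ℂ m m'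
  perm : ∀ (i : ℕ) (hi : i + 1 < N) u m,
    J (youngGen i hi u) m =
      permRep N (Equiv.swap ⟨i, Nat.lt_of_succ_lt hi⟩ ⟨i + 1, hi⟩) (J u m)
  sl : ∀ (g : Matrix.SpecialLinearGroup (Fin 2) ℂ) u m, J u (symAct k g m) = slRep N g (J u m)

/-! ## Parameters of Schur–Weyl embeddings -/

/-- Unit vectors `h = p t₂₁ + q t₁₂`. -/
structure Param where
  /-- The coordinate at `t₂₁`. -/
  p : ℂ
  /-- The coordinate at `t₁₂`. -/
  q : ℂ
  unit : ‖p‖ ^ 2 + ‖q‖ ^ 2 = 1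

/-- The embedding `π_λ ↪ π_μ`, `μ = (λ₁ + 1, λ₂ + 1)`, determined by `h = p t₂₁ + q t₁₂`: a tableau
`t` is sent to `p` times its extension by a cell in the second and then a cell in the first row,
plus `q` times its extension by a cell in the first and then a cell in the second row.
(If `λ₁ = λ₂`, the first extension does not exist and its term is `0`.) -/
def pathEmbedding {N k : ℕ} (h : Param) : YoungSpace N k →ₗ[ℂ] YoungSpace (N + 2) k :=
  (EuclideanSpace.basisFun (Tableau N k) ℂ).toBasis.constr ℂ fun t =>
    h.p • youngVec (Fin.snoc (Fin.snoc t.1 (1 : Fin 2) : Fin (N + 1) → Fin 2) (0 : Fin 2)) +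
    h.q • youngVec (Fin.snoc (Fin.snoc t.1 (0 : Fin 2) : Fin (N + 1) → Fin 2) (1 : Fin 2))

/-- In the components with `λ₁ - λ₂ = μ₁ - μ₂ = k`, the map `ι` is the embedding
`π_λ ⊗ M_{k+1} ↪ π_μ ⊗ M_{k+1}` determined by `h`. -/
def HasParam {N : ℕ} (ι : Tens N →ₗ[ℂ] Tens (N + 2)) (k : ℕ) (h : Param) : Prop :=
  ∃ (J : YoungSpace N k →ₗ[ℂ] symTens k →ₗ[ℂ] Tens N)
    (J' : YoungSpace (N + 2) k →ₗ[ℂ] symTens k →ₗ[ℂ] Tens (N + 2)),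
    IsComponent J ∧ IsComponent J' ∧ ∀ u m, ι (J u m) = J' (pathEmbedding h u) m

/-! ## The random walk on infinite tableaux -/

/-- Infinite Young tableaux with at most two rows. -/
abbrev InfTableau : Type :=
  {τ : ℕ → Fin 2 // ∀ m : ℕ, ((Finset.range m).filter fun j => τ j = 1).card ≤
    ((Finset.range m).filter fun j => τ j = 0).card}

/-- The continuation of `t` by double steps: at the `m`-th of them a cell is put into the row `ε m`
and then a cell into the other row, so `ε m = 1` is the step `t₂₁` and `ε m = 0` the step `t₁₂`. -/
def walk {N : ℕ} (t : Fin N → Fin 2) (ε : ℕ → Fin 2) (i : ℕ) : Fin 2 :=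
  if hi : i < N then t ⟨i, hi⟩
  else if (i - N) % 2 = 0 then ε ((i - N) / 2) else 1 - ε ((i - N) / 2)

/-- The law of one double step: `t₂₁` with probability `|p|²`, `t₁₂` with probability `|q|²`. -/
def stepLaw (h : Param) : Measure (Fin 2) :=
  ENNReal.ofReal (‖h.p‖ ^ 2) • Measure.dirac 1 + ENNReal.ofReal (‖h.q‖ ^ 2) • Measure.dirac 0

instance (h : Param) : IsProbabilityMeasure (stepLaw h) := by
  constructor
  simp only [stepLaw, Measure.coe_add, Measure.coe_smul, Pi.add_apply, Pi.smul_apply,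
    measure_univ, smul_eq_mul, mul_one]
  rw [← ENNReal.ofReal_add (by positivity) (by positivity), h.unit, ENNReal.ofReal_one]

/-- The measure `μ_t^h` on the space of infinite tableaux: the distribution of the random walk that
starts from `t`, `λ₁ - λ₂ = k`, and makes independent double steps; the step from the level `n`
to the level `n + 2` has the law given by `h_j`, `j = (n - k) / 2`. -/
def walkMeasure {N k : ℕ} (h : ℕ → Param) (t : Tableau N k) : Measure InfTableau :=
  ((Measure.infinitePi fun m : ℕ => stepLaw (h ((N + 2 * m - k) / 2))).map (walk t.1)).comap
    Subtype.val

end SchurWeyl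

end

noncomputable section

namespace SchurWeyl

/-! ## Tensor products with a fixed tensor -/

/-! The map `v ↦ v ⊗ w` commutes with `SL(2,ℂ)` exactly when `w` is invariant, and the invariants of
`(ℂ²)^{⊗2}` form the line of the singlet; isometry then fixes `|c| = 1`.

For the parameters, the primary component is built explicitly. A tableau prescribes a chain of
Clebsch–Gordan embeddings, one for each cell: `up` (first row) or `down` (second row). Each step is
isometric and equivariant, and the two kinds have orthogonal images, so the chains of a given shape
give an isometric `SL(2,ℂ)`-equivariant map (`sum_conj_pathVal_mul_pathVal`, `pathVal_of_isImage`).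
Exchanging two neighbouring factors involves only two consecutive steps, and the relations between
these are Young's orthogonal form (`orthogonalForm_of_isTableau`).

In this model `up ∘ down` minus `down ∘ up`, not normalized, is a multiple of the alternating tensor
(`up_rawDown_sub_rawDown_up`). Normalizing the two terms gives `-coeffP` and `coeffQ`, so these are
parameters. Conversely, for any `J`, `J'`, the last transposition acts by `-1` on `v ⊗ v₀`, and for
`k > 0` the `-1` eigenspace in the plane of `t t₂₁`, `t t₁₂` is a line. For `k = 0` only `t t₁₂`
exists, and the norm decides. No appeal to Schur's lemma is needed.

Finally, the walk almost surely stays among tableaux: for `k > 0` always, for `k = 0` because `p =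
0`. So its cylinders have the product probabilities of independent steps. -/

theorem norm_tmul {N M : ℕ} (v : Tens N) (w : Tens M) : ‖tmul v w‖ = ‖v‖ * ‖w‖ := by
  rw [EuclideanSpace.norm_eq, EuclideanSpace.norm_eq, EuclideanSpace.norm_eq,
    ← Real.sqrt_mul (by positivity), Finset.sum_mul_sum, ← Fintype.sum_prod_type']
  congr 1
  refine Fintype.sum_equiv (Fin.appendEquiv N M).symm _ _ fun x => ?_
  simp [tmul, Fin.appendEquiv, mul_pow]

theorem permRep_tmul {N M : ℕ} (σ : Equiv.Perm (Fin N)) (v : Tens N) (w : Tens M) :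
    permRep (N + M) (permIncl M σ) (tmul v w) = tmul (permRep N σ v) w := by
  ext x
  simp [permRep, tmul, permIncl, Function.comp_def, Equiv.permCongr_apply]

theorem slRep_tmul {N M : ℕ} (g : Matrix.SpecialLinearGroup (Fin 2) ℂ) (v : Tens N) (w : Tens M) :
    slRep (N + M) g (tmul v w) = tmul (slRep N g v) (slRep M g w) := by
  ext x
  simp only [slRep, tmul, MonoidHom.coe_mk, OneHom.coe_mk, LinearMap.coe_mk, AddHom.coe_mk]
  rw [Finset.sum_mul_sum, ← Fintype.sum_prod_type']
  refine Fintype.sum_equiv (Fin.appendEquiv N M).symm _ _ fun y => ?_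
  simp [Fin.appendEquiv, Fin.prod_univ_add]
  ring

theorem tmul_ne_zero {N M : ℕ} {v : Tens N} {w : Tens M} (hv : v ≠ 0) (hw : w ≠ 0) :
    tmul v w ≠ 0 := by
  rw [← norm_ne_zero_iff, norm_tmul]
  exact mul_ne_zero (norm_ne_zero_iff.2 hv) (norm_ne_zero_iff.2 hw)

theorem slRep_two_apply (g : Matrix.SpecialLinearGroup (Fin 2) ℂ) (w : Tens 2) (a b : Fin 2) :
    slRep 2 g w ![a, b] = ∑ c, ∑ d, g a c * g b d * w ![c, d] := by
  simp only [slRep, MonoidHom.coe_mk, OneHom.coe_mk, LinearMap.coe_mk, AddHom.coe_mk]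
  rw [← Fintype.sum_prod_type']
  refine Fintype.sum_equiv (finTwoArrowEquiv (Fin 2)) _ _ fun y => ?_
  have : ![y 0, y 1] = y := by ext i; fin_cases i <;> rfl
  simp [Fin.prod_univ_two, finTwoArrowEquiv, this]

theorem tens_two_ext {v w : Tens 2} (h : ∀ a b, v ![a, b] = w ![a, b]) : v = w := by
  ext y
  have : ![y 0, y 1] = y := by ext i; fin_cases i <;> rfl
  rw [← this, h]

theorem singlet_apply (a b : Fin 2) :
    singlet ![a, b] = if a = b then 0 else if a = 0 then ((1 / √2 : ℝ) : ℂ)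
      else -((1 / √2 : ℝ) : ℂ) := by
  have h1 : ∀ a b c d : Fin 2, (![a, b] = ![c, d]) ↔ (a = c ∧ b = d) := by decide
  fin_cases a <;> fin_cases b <;> simp [singlet, h1]

theorem norm_singlet : ‖singlet‖ = 1 := by
  rw [EuclideanSpace.norm_eq, Real.sqrt_eq_one,
    ← Equiv.sum_comp (finTwoArrowEquiv (Fin 2)).symm, Fintype.sum_prod_type]
  simp only [finTwoArrowEquiv_symm_apply, Fin.sum_univ_two, singlet_apply]
  simp
  norm_num

theorem slRep_singlet (g : Matrix.SpecialLinearGroup (Fin 2) ℂ) : slRep 2 g singlet = singlet := by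
  have hdet := g.det_coe
  rw [Matrix.det_fin_two] at hdet
  refine tens_two_ext fun a b => ?_
  rw [slRep_two_apply]
  simp only [singlet_apply, Fin.sum_univ_two]
  fin_cases a <;> fin_cases b <;> simp
  · ring
  · linear_combination ((√2 : ℂ)⁻¹) * hdet
  · linear_combination (-(√2 : ℂ)⁻¹) * hdet
  · ring

theorem eq_smul_singlet_of_slRep {w : Tens 2} (h : ∀ g, slRep 2 g w = w) :
    ∃ c : ℂ, w = c • singlet := by
  have key : ∀ (g : Matrix.SpecialLinearGroup (Fin 2) ℂ) (a b : Fin 2), ∑ c, ∑ d, g a c * g b d * w ![c, d] = w ![a, b] := fun g a b => by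
    rw [← slRep_two_apply, h]
  -- The diagonal matrix scales the coordinates at `00` and `11` by `4` and `1/4`, which forces them
  -- to vanish; the unipotent one then gives antisymmetry.
  have hd : ((!![2, 0; 0, 2⁻¹] : Matrix (Fin 2) (Fin 2) ℂ)).det = 1 := by
    simp [Matrix.det_fin_two]
  have hs : ((!![1, 1; 0, 1] : Matrix (Fin 2) (Fin 2) ℂ)).det = 1 := by
    simp [Matrix.det_fin_two]
  have h00 := key ⟨_, hd⟩ 0 0
  have h11 := key ⟨_, hd⟩ 1 1
  have h01 := key ⟨_, hs⟩ 0 0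
  simp [Fin.sum_univ_two] at h00 h11 h01
  have e00 : w ![0, 0] = 0 := by linear_combination (1 / 3 : ℂ) * h00
  have e11 : w ![1, 1] = 0 := by linear_combination (-4 / 3 : ℂ) * h11
  have e10 : w ![1, 0] = - w ![0, 1] := by linear_combination h01 - e11
  refine ⟨(√2 : ℝ) * w ![0, 1], tens_two_ext fun a b => ?_⟩
  have h2 : (√2 : ℂ) ≠ 0 := by simp
  rw [PiLp.smul_apply, singlet_apply]
  fin_cases a <;> fin_cases b <;> simp [e00, e11, e10] <;> field_simp

theorem isSchurWeylEmbedding_tmulRight_iff (N : ℕ) (w : Tens 2) :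
    IsSchurWeylEmbedding (tmulRight N w) ↔ ∃ c : ℂ, ‖c‖ = 1 ∧ w = c • singlet := by
  constructor
  · intro h
    let e : Tens N := EuclideanSpace.single 0 1
    have hn : ‖e‖ = 1 := by simp [e]
    have he : e ≠ 0 := by rw [← norm_ne_zero_iff, hn]; exact one_ne_zero
    have hw : ‖w‖ = 1 := by
      have := h.isometry e
      simpa [tmulRight, norm_tmul, hn] using this
    obtain ⟨c, rfl⟩ := eq_smul_singlet_of_slRep (w := w) fun g => by
      -- Equivariance at `g⁻¹ e` yields `e ⊗ w = e ⊗ g w`, from which the nonzero factor `e` is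
      -- cancelled.
      have h1 := h.sl g (slRep N g⁻¹ e)
      have h2 : slRep N g (slRep N g⁻¹ e) = e := by
        rw [← Module.End.mul_apply, ← map_mul, mul_inv_cancel, map_one, Module.End.one_apply]
      have h3 : tmul e w = tmul e (slRep 2 g w) := by
        have h4 := slRep_tmul g (slRep N g⁻¹ e) w
        rw [h2] at h1 h4
        exact h1.trans h4
      by_contra hne
      refine tmul_ne_zero he (sub_ne_zero.2 hne) ?_
      ext x
      have h5 := congrArg (fun v => v x) h3
      simp only [tmul] at h5 ⊢
      simp [mul_sub, h5]
    refine ⟨c, ?_, rfl⟩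
    rwa [norm_smul, norm_singlet, mul_one] at hw
  · rintro ⟨c, hc, rfl⟩
    refine ⟨fun v => ?_, fun σ v => ?_, fun g v => ?_⟩
    · simp [tmulRight, norm_tmul, norm_smul, hc, norm_singlet]
    · exact (permRep_tmul σ v _).symm
    · refine Eq.trans ?_ (slRep_tmul g v _).symm
      rw [map_smul, slRep_singlet]; rfl

theorem isSchurWeylEmbedding_tensorEmbedding (N : ℕ) :
    IsSchurWeylEmbedding (tensorEmbedding N) :=
  (isSchurWeylEmbedding_tmulRight_iff N singlet).2 ⟨1, by simp, by simp⟩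

/-! ## Extension of words by a letter -/

/-- The word `f` with the letter `s` added at the end. -/
abbrev extend {N : ℕ} (f : Fin N → Fin 2) (s : Fin 2) : Fin (N + 1) → Fin 2 :=
  Fin.snoc (α := fun _ => Fin 2) f s

theorem exists_eq_extend {N : ℕ} (f : Fin (N + 1) → Fin 2) : ∃ f' s, f = extend f' s :=
  ⟨Fin.init f, f (Fin.last N), (Fin.snoc_init_self f).symm⟩

theorem extend_inj {N : ℕ} {f g : Fin N → Fin 2} {s s' : Fin 2} :
    extend f s = extend g s' ↔ f = g ∧ s = s' := Fin.snoc_inj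

theorem sum_extend {M : Type*} [AddCommMonoid M] {N : ℕ} (F : (Fin (N + 1) → Fin 2) → M) :
    ∑ x, F x = ∑ x, ∑ a, F (extend x a) := by
  rw [← Fintype.sum_prod_type' fun x a => F (extend x a)]
  refine (Fintype.sum_equiv
    ((Equiv.prodComm _ _).trans (Fin.snocEquiv fun _ => Fin 2)) _ _ fun p => rfl).symm

theorem countBelow_extend_of_le {N : ℕ} (f : Fin N → Fin 2) (s a : Fin 2) {m : ℕ} (hm : m ≤ N) :
    countBelow (extend f s) a m = countBelow f a m := by
  simp only [countBelow, Finset.card_filter, Fin.sum_univ_castSucc, Fin.val_castSucc,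
    Fin.snoc_castSucc, Fin.val_last]
  simp [hm.not_gt]

theorem countBelow_extend_last {N : ℕ} (f : Fin N → Fin 2) (s a : Fin 2) :
    countBelow (extend f s) a (N + 1) = countBelow f a N + if s = a then 1 else 0 := by
  simp only [countBelow, Finset.card_filter, Fin.sum_univ_castSucc, Fin.val_castSucc,
    Fin.snoc_castSucc, Fin.val_last, Fin.snoc_last]
  congr 1
  · refine Finset.sum_congr rfl fun j _ => ?_
    simp [j.2.trans (Nat.lt_succ_self N)]
  · simp

theorem isTableau_zero {k : ℕ} {f : Fin 0 → Fin 2} : IsTableau k f ↔ k = 0 := by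
  simp [IsTableau, countBelow, eq_comm]

theorem isTableau_extend_zero {N k : ℕ} {f : Fin N → Fin 2} :
    IsTableau k (extend f 0) ↔ ∃ k', k = k' + 1 ∧ IsTableau k' f := by
  have h0 := countBelow_extend_last f 0 0
  have h1 := countBelow_extend_last f 0 1
  simp at h0 h1
  constructor
  · rintro ⟨h, e⟩
    have hN := h N (Nat.le_succ N)
    rw [countBelow_extend_of_le _ _ _ le_rfl, countBelow_extend_of_le _ _ _ le_rfl] at hN
    refine ⟨k - 1, by omega, fun m hm => ?_, by omega⟩
    have := h m (by omega)
    rwa [countBelow_extend_of_le _ _ _ hm, countBelow_extend_of_le _ _ _ hm] at this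
  · rintro ⟨k', rfl, h, e⟩
    refine ⟨fun m hm => ?_, by omega⟩
    rcases Nat.lt_or_ge N m with hm' | hm'
    · obtain rfl : m = N + 1 := by omega
      omega
    · rw [countBelow_extend_of_le _ _ _ hm', countBelow_extend_of_le _ _ _ hm']
      exact h m hm'

theorem isTableau_extend_one {N k : ℕ} {f : Fin N → Fin 2} :
    IsTableau k (extend f 1) ↔ IsTableau (k + 1) f := by
  have h0 := countBelow_extend_last f 1 0
  have h1 := countBelow_extend_last f 1 1
  simp at h0 h1
  constructor
  · rintro ⟨h, e⟩
    refine ⟨fun m hm => ?_, by omega⟩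
    have := h m (by omega)
    rwa [countBelow_extend_of_le _ _ _ hm, countBelow_extend_of_le _ _ _ hm] at this
  · rintro ⟨h, e⟩
    refine ⟨fun m hm => ?_, by omega⟩
    rcases Nat.lt_or_ge N m with hm' | hm'
    · obtain rfl : m = N + 1 := by omega
      omega
    · rw [countBelow_extend_of_le _ _ _ hm', countBelow_extend_of_le _ _ _ hm']
      exact h m hm'

theorem IsTableau.unique {N k k' : ℕ} {f : Fin N → Fin 2} (h : IsTableau k f)
    (h' : IsTableau k' f) : k = k' := by
  have := h.2
  have := h'.2
  omega

/-- Needed for uniqueness of the parameter: in a zero component the relation `ι ∘ J = J' ∘ i_h`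
would not restrict `h`. -/
theorem exists_isTableau (k n : ℕ) : ∃ f : Fin (k + 2 * n) → Fin 2, IsTableau k f := by
  induction n with
  | zero =>
    induction k with
    | zero => exact ⟨Fin.elim0, isTableau_zero.2 rfl⟩
    | succ k ih =>
      obtain ⟨f, hf⟩ := ih
      exact ⟨extend f 0, isTableau_extend_zero.2 ⟨k, rfl, hf⟩⟩
  | succ n ih =>
    obtain ⟨f, hf⟩ := ih
    exact ⟨extend (extend f 0) 1, isTableau_extend_one.2 (isTableau_extend_zero.2 ⟨k, rfl, hf⟩)⟩

theorem content_extend_castSucc {N : ℕ} (f : Fin N → Fin 2) (s : Fin 2) (i : Fin N) :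
    content (extend f s) i.castSucc = content f i := by
  simp only [content, Fin.snoc_castSucc, Fin.val_castSucc]
  rw [countBelow_extend_of_le _ _ _ i.2.le]

theorem content_extend_last {N : ℕ} (f : Fin N → Fin 2) (s : Fin 2) :
    content (extend f s) (Fin.last N) = countBelow f s N - ((s : ℕ) : ℤ) := by
  simp only [content, Fin.snoc_last, Fin.val_last]
  rw [countBelow_extend_of_le _ _ _ le_rfl]

/-! ## The Clebsch–Gordan maps

A symmetric tensor in `(ℂ²)^{⊗k}` is described by the function `φ : ℕ → ℂ`, where `φ j` is its
coordinate at the words with `j` letters `1`. -/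

/-- The component with the last factor `e_a` of a symmetric tensor. -/
def up (a : Fin 2) : (ℕ → ℂ) →ₗ[ℂ] (ℕ → ℂ) where
  toFun φ j := φ (j + a)
  map_add' _ _ := rfl
  map_smul' _ _ := rfl

/-- The component with the last factor `e_a` of the embedding
`M_K → M_{K+1} ⊗ ℂ²`, not normalized. -/
def rawDown (K : ℕ) (a : Fin 2) : (ℕ → ℂ) →ₗ[ℂ] (ℕ → ℂ) where
  toFun φ j := if a = 0 then -(j : ℂ) * φ (j - 1) else ((K : ℂ) - j) * φ j
  map_add' _ _ := by ext j; dsimp; split_ifs <;> ring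
  map_smul' _ _ := by ext j; dsimp; split_ifs <;> ring

/-- The constant that makes `rawDown K` an isometry. -/
def downConst (K : ℕ) : ℝ := (√(K * (K + 1)))⁻¹

/-- The component with the last factor `e_a` of the isometric embedding `M_K → M_{K+1} ⊗ ℂ²`. -/
def down (K : ℕ) (a : Fin 2) : (ℕ → ℂ) →ₗ[ℂ] (ℕ → ℂ) := (downConst K : ℂ) • rawDown K a

/-- The coordinate at the word `x` of the embedding of `M_{k+1}` that corresponds to the
tableau `f`. -/
def pathVal : (N : ℕ) → ℕ → (Fin N → Fin 2) → (Fin N → Fin 2) → (ℕ → ℂ) →ₗ[ℂ] ℂ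
  | 0, _, _, _ => LinearMap.proj 0
  | N + 1, k, f, x =>
    if f (Fin.last N) = 0 then pathVal N (k - 1) (Fin.init f) (Fin.init x) ∘ₗ up (x (Fin.last N))
    else pathVal N (k + 1) (Fin.init f) (Fin.init x) ∘ₗ down (k + 1) (x (Fin.last N))

theorem pathVal_extend_zero {N : ℕ} (k : ℕ) (f x : Fin N → Fin 2) (a : Fin 2) (φ : ℕ → ℂ) :
    pathVal (N + 1) (k + 1) (extend f 0) (extend x a) φ = pathVal N k f x (up a φ) := by
  simp [pathVal]

theorem pathVal_extend_one {N : ℕ} (k : ℕ) (f x : Fin N → Fin 2) (a : Fin 2) (φ : ℕ → ℂ) :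
    pathVal (N + 1) k (extend f 1) (extend x a) φ = pathVal N (k + 1) f x (down (k + 1) a φ) := by
  simp [pathVal]

/-! ### Isometry -/

/-- The inner product of `M_{k+1}` in terms of coordinates. -/
def coordInner (k : ℕ) (φ ψ : ℕ → ℂ) : ℂ :=
  ∑ j ∈ Finset.range (k + 1), (k.choose j : ℂ) * (starRingEnd ℂ (φ j) * ψ j)

/-- Pascal's rule in summed form: words of length `k + 1` are split by their last letter. -/
theorem sum_choose_succ_mul_eq (k : ℕ) (F : ℕ → ℂ) :
    ∑ j ∈ Finset.range (k + 2), ((k + 1).choose j : ℂ) * F j =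
      ∑ j ∈ Finset.range (k + 1), (k.choose j : ℂ) * (F j + F (j + 1)) := by
  rw [Finset.sum_range_succ']
  simp only [Nat.choose_succ_succ, Nat.cast_add, add_mul, mul_add, Finset.sum_add_distrib]
  have h := Finset.sum_range_succ' (fun j => (k.choose j : ℂ) * F j) (k + 1)
  rw [Finset.sum_range_succ] at h
  simp at h
  simp
  linear_combination -h

theorem sum_coordInner_up (k : ℕ) (φ ψ : ℕ → ℂ) :
    ∑ a, coordInner k (up a φ) (up a ψ) = coordInner (k + 1) φ ψ := by
  rw [Fin.sum_univ_two, coordInner, coordInner, coordInner, sum_choose_succ_mul_eq k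
    fun j => starRingEnd ℂ (φ j) * ψ j, ← Finset.sum_add_distrib]
  refine Finset.sum_congr rfl fun j _ => ?_
  simp [up]
  ring

theorem succ_mul_choose_succ_cast (k j : ℕ) :
    ((j : ℂ) + 1) * ((k + 1).choose (j + 1) : ℂ) = (k + 1) * (k.choose j : ℂ) := by
  have := Nat.add_one_mul_choose_eq k j
  have h : ((k : ℂ) + 1) * (k.choose j : ℂ) = ((k + 1).choose (j + 1) : ℂ) * (j + 1) := by
    exact_mod_cast this
  rw [h, mul_comm]

theorem sub_mul_choose_cast {k j : ℕ} (hj : j ≤ k) :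
    ((k : ℂ) + 1 - j) * ((k + 1).choose j : ℂ) = (k + 1) * (k.choose j : ℂ) := by
  have := Nat.add_one_mul_choose_eq k j
  have h2 := Nat.choose_succ_right_eq (k + 1) j
  have h : ((k + 1).choose (j + 1) : ℂ) * (j + 1) = (k + 1).choose j * (k + 1 - j) := by
    have e : ((k + 1 - j : ℕ) : ℂ) = k + 1 - j := by
      rw [Nat.cast_sub (by omega)]; push_cast; ring
    rw [← e]; exact_mod_cast h2
  rw [← succ_mul_choose_succ_cast, mul_comm, ← h, mul_comm]

theorem sum_coordInner_rawDown (k : ℕ) (φ ψ : ℕ → ℂ) :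
    ∑ a, coordInner (k + 1) (rawDown (k + 1) a φ) (rawDown (k + 1) a ψ) =
      (k + 1) * (k + 2) * coordInner k φ ψ := by
  rw [Fin.sum_univ_two]
  simp only [coordInner]
  -- For `a = 0` the term `j = 0` vanishes and for `a = 1` the term `j = k + 1`; without them both
  -- sums run over the index set of `coordInner k`. The remaining weights add up as `(j + 1) + (k +
  -- 1 - j) = k + 2`.
  rw [Finset.sum_range_succ', Finset.sum_range_succ _ (k + 1)]
  simp only [rawDown]
  simp only [LinearMap.coe_mk, AddHom.coe_mk, Finset.mul_sum]
  simp only [if_true, one_ne_zero, if_false]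
  simp only [Nat.cast_zero, neg_zero, zero_mul, map_zero, mul_zero, add_zero, sub_self]
  rw [← Finset.sum_add_distrib]
  refine Finset.sum_congr rfl fun j hj => ?_
  have h1 := succ_mul_choose_succ_cast k j
  have h2 := sub_mul_choose_cast (k := k) (j := j) (by simpa [Nat.lt_succ_iff] using hj)
  simp
  linear_combination (starRingEnd ℂ (φ j) * ψ j) * ((j + 1) * h1 + (k + 1 - j) * h2)

theorem downConst_mul_self (k : ℕ) :
    (downConst (k + 1) : ℂ) * downConst (k + 1) * ((k + 1) * (k + 2)) = 1 := by
  have h : downConst (k + 1) * downConst (k + 1) * (((k : ℝ) + 1) * (k + 2)) = 1 := by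
    rw [downConst, ← mul_inv, Real.mul_self_sqrt (by positivity)]
    push_cast
    rw [add_assoc, one_add_one_eq_two]
    exact inv_mul_cancel₀ (by positivity)
  exact_mod_cast h

theorem sum_coordInner_down (k : ℕ) (φ ψ : ℕ → ℂ) :
    ∑ a, coordInner (k + 1) (down (k + 1) a φ) (down (k + 1) a ψ) = coordInner k φ ψ := by
  have h : ∀ a, coordInner (k + 1) (down (k + 1) a φ) (down (k + 1) a ψ) =
      (downConst (k + 1) : ℂ) * downConst (k + 1) *
        coordInner (k + 1) (rawDown (k + 1) a φ) (rawDown (k + 1) a ψ) := fun a => by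
    simp only [coordInner, Finset.mul_sum, down, LinearMap.smul_apply, Pi.smul_apply, smul_eq_mul,
      map_mul, Complex.conj_ofReal]
    exact Finset.sum_congr rfl fun j _ => by ring
  simp only [h, ← Finset.mul_sum]
  rw [sum_coordInner_rawDown, ← mul_assoc, downConst_mul_self, one_mul]

/-- The two letters contribute opposite terms, since `(j + 1) * C(k+1, j+1)` and `(k + 1 - j) *
C(k+1, j)` are both `(k + 1) * C(k, j)`. -/
theorem sum_coordInner_up_rawDown (k : ℕ) (φ ψ : ℕ → ℂ) :
    ∑ a, coordInner (k + 1) (up a φ) (rawDown (k + 1) a ψ) = 0 := by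
  rw [Fin.sum_univ_two]
  simp only [coordInner]
  rw [Finset.sum_range_succ', Finset.sum_range_succ _ (k + 1)]
  simp only [rawDown, up]
  simp only [LinearMap.coe_mk, AddHom.coe_mk]
  simp only [if_true, one_ne_zero, if_false]
  simp only [Nat.cast_zero, neg_zero, zero_mul, mul_zero, add_zero, sub_self]
  rw [← Finset.sum_add_distrib]
  refine Finset.sum_eq_zero fun j hj => ?_
  have h1 := succ_mul_choose_succ_cast k j
  have h2 := sub_mul_choose_cast (k := k) (j := j) (by simpa [Nat.lt_succ_iff] using hj)
  simp
  linear_combination (starRingEnd ℂ (φ (j + 1)) * ψ j) * (h2 - h1)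

theorem sum_coordInner_up_down (k : ℕ) (φ ψ : ℕ → ℂ) :
    ∑ a, coordInner (k + 1) (up a φ) (down (k + 1) a ψ) = 0 := by
  have h : ∀ a, coordInner (k + 1) (up a φ) (down (k + 1) a ψ) =
      (downConst (k + 1) : ℂ) * coordInner (k + 1) (up a φ) (rawDown (k + 1) a ψ) := fun a => by
    simp only [coordInner, Finset.mul_sum, down, LinearMap.smul_apply, Pi.smul_apply, smul_eq_mul]
    exact Finset.sum_congr rfl fun j _ => by ring
  simp only [h, ← Finset.mul_sum]
  rw [sum_coordInner_up_rawDown, mul_zero]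

theorem coordInner_conj (k : ℕ) (φ ψ : ℕ → ℂ) :
    starRingEnd ℂ (coordInner k φ ψ) = coordInner k ψ φ := by
  simp [coordInner, mul_comm]

theorem sum_coordInner_down_up (k : ℕ) (φ ψ : ℕ → ℂ) :
    ∑ a, coordInner (k + 1) (down (k + 1) a φ) (up a ψ) = 0 := by
  simp only [← coordInner_conj _ (up _ ψ), ← map_sum]
  rw [sum_coordInner_up_down, map_zero]

/-- Induction on the last cell: equal rows use that a step is an isometry, different rows that `up`
and `down` have orthogonal images. Different shapes are admitted because removing cells from
different rows changes `k` and `k'` in opposite directions. -/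
theorem sum_conj_pathVal_mul_pathVal {N : ℕ} {k k' : ℕ} {f g : Fin N → Fin 2}
    (hf : IsTableau k f) (hg : IsTableau k' g) (φ ψ : ℕ → ℂ) :
    ∑ x, starRingEnd ℂ (pathVal N k f x φ) * pathVal N k' g x ψ =
      if f = g then coordInner k φ ψ else 0 := by
  induction N generalizing k k' φ ψ with
  | zero =>
    rw [isTableau_zero] at hf hg
    subst hf hg
    simp [pathVal, coordInner, Subsingleton.elim f g]
  | succ N ih =>
    obtain ⟨f, s, rfl⟩ := exists_eq_extend f
    obtain ⟨g, s', rfl⟩ := exists_eq_extend g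
    rw [sum_extend, Finset.sum_comm]
    simp only [extend_inj]
    by_cases hs : s = 0 <;> by_cases hs' : s' = 0
    · subst hs hs'
      obtain ⟨k, rfl, hf₀⟩ := isTableau_extend_zero.1 hf
      obtain ⟨k', rfl, hg₀⟩ := isTableau_extend_zero.1 hg
      simp only [pathVal_extend_zero, ih hf₀ hg₀]
      split_ifs with h h' h'
      · exact sum_coordInner_up k φ ψ
      · simp [h] at h'
      · simp [h'] at h
      · simp
    · obtain rfl : s' = 1 := by omega
      subst hs
      obtain ⟨k, rfl, hf₀⟩ := isTableau_extend_zero.1 hf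
      rw [isTableau_extend_one] at hg
      simp only [pathVal_extend_zero, pathVal_extend_one, ih hf₀ hg]
      rw [if_neg (by simp)]
      split_ifs with h
      · subst h
        obtain rfl := hf₀.unique hg
        exact sum_coordInner_up_down k' φ ψ
      · simp
    · obtain rfl : s = 1 := by omega
      subst hs'
      obtain ⟨k', rfl, hg₀⟩ := isTableau_extend_zero.1 hg
      rw [isTableau_extend_one] at hf
      simp only [pathVal_extend_zero, pathVal_extend_one, ih hf hg₀]
      rw [if_neg (by simp)]
      split_ifs with h
      · subst h
        exact sum_coordInner_down_up k φ ψ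
      · simp
    · obtain rfl : s = 1 := by omega
      obtain rfl : s' = 1 := by omega
      rw [isTableau_extend_one] at hf hg
      simp only [pathVal_extend_one, ih hf hg]
      split_ifs with h h' h'
      · subst h
        obtain rfl : k = k' := by have := hf.unique hg; omega
        exact sum_coordInner_down k φ ψ
      · simp [h] at h'
      · simp [h'] at h
      · simp

/-! ### Equivariance with respect to `SL(2,ℂ)` -/

/-- The number of letters `1` in a word. -/
def wt {N : ℕ} (x : Fin N → Fin 2) : ℕ := ∑ i, (x i : ℕ)

theorem wt_extend {N : ℕ} (x : Fin N → Fin 2) (a : Fin 2) : wt (extend x a) = wt x + a := by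
  simp [wt, Fin.sum_univ_castSucc]

/-- The symmetric tensor with coordinates `ψ` is the image under `g` of the one with
coordinates `φ`. -/
def IsImage (k : ℕ) (g : Matrix.SpecialLinearGroup (Fin 2) ℂ) (φ ψ : ℕ → ℂ) : Prop :=
  ∀ x : Fin k → Fin 2, ψ (wt x) = ∑ y : Fin k → Fin 2, (∏ i, g (x i) (y i)) * φ (wt y)

/-- Since `g` acts on the last factor as well, the component `b` of the image collects the
components `a` with weights `g b a`. In this form, shared with `IsImage.down`, the last factor can
be peeled off inductively. -/
theorem IsImage.up {k : ℕ} {g : Matrix.SpecialLinearGroup (Fin 2) ℂ} {φ ψ : ℕ → ℂ}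
    (h : IsImage (k + 1) g φ ψ) (b : Fin 2) :
    IsImage k g (∑ a, g b a • SchurWeyl.up a φ) (SchurWeyl.up b ψ) := by
  intro x
  have := h (extend x b)
  rw [wt_extend, sum_extend] at this
  simp only [SchurWeyl.up, LinearMap.coe_mk, AddHom.coe_mk]
  rw [this]
  refine Finset.sum_congr rfl fun y _ => ?_
  simp only [Fin.prod_univ_castSucc, Fin.snoc_castSucc, Fin.snoc_last, wt_extend,
    Finset.sum_apply, Finset.mul_sum, Pi.smul_apply, smul_eq_mul, mul_assoc]

/-- The coordinates of `e₁ ⊗ e₂ - e₂ ⊗ e₁`. -/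
def alt (c a : Fin 2) : ℂ := if c = a then 0 else if c = 0 then 1 else -1

theorem sum_mul_alt (g : Matrix.SpecialLinearGroup (Fin 2) ℂ) (a b : Fin 2) :
    ∑ c, ∑ d, g a c * g b d * alt c d = alt a b := by
  have hdet := g.det_coe
  rw [Matrix.det_fin_two] at hdet
  simp only [alt, Fin.sum_univ_two]
  fin_cases a <;> fin_cases b <;> simp
  · ring
  · linear_combination hdet
  · linear_combination -hdet
  · ring

/-- Coordinate-free meaning of `rawDown`: sum over all places `i` of the tensor with an alternating
pair in the place `i` and the last place, and the given symmetric tensor in the others. Equivariance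
is visible here. -/
theorem rawDown_wt {k : ℕ} (x : Fin (k + 1) → Fin 2) (a : Fin 2) (φ : ℕ → ℂ) :
    rawDown (k + 1) a φ (wt x) = ∑ i, alt (x i) a * φ (wt (i.removeNth x)) := by
  have hw : ∀ i, wt x = x i + wt (i.removeNth x) := fun i => by
    simp [wt, Fin.sum_univ_succAbove _ i, Fin.removeNth]
  have h0 : ∀ i, alt (x i) 0 * φ (wt (i.removeNth x)) = -((x i : ℕ) : ℂ) * φ (wt x - 1) :=
    fun i => by
      have := hw i
      rcases (by omega : x i = 0 ∨ x i = 1) with h | h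
      · simp [h, alt]
      · rw [h] at this ⊢
        simp [alt, this]
  have h1 : ∀ i, alt (x i) 1 * φ (wt (i.removeNth x)) = (1 - ((x i : ℕ) : ℂ)) * φ (wt x) :=
    fun i => by
      have := hw i
      rcases (by omega : x i = 0 ∨ x i = 1) with h | h
      · rw [h] at this ⊢
        simp [alt, this]
      · simp [h, alt]
  have hs : (wt x : ℂ) = ∑ i, ((x i : ℕ) : ℂ) := by simp [wt]
  fin_cases a
  · simp only [Fin.zero_eta, h0, ← Finset.sum_mul, Finset.sum_neg_distrib, ← hs]
    simp [rawDown]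
  · simp only [Fin.mk_one, h1, ← Finset.sum_mul, Finset.sum_sub_distrib, ← hs]
    simp [rawDown]

theorem sum_insertNth {M : Type*} [AddCommMonoid M] {k : ℕ} (i : Fin (k + 1))
    (F : (Fin (k + 1) → Fin 2) → M) :
    ∑ x, F x = ∑ c, ∑ x : Fin k → Fin 2, F (i.insertNth (α := fun _ => Fin 2) c x) := by
  rw [← Fintype.sum_prod_type' fun c x => F (i.insertNth (α := fun _ => Fin 2) c x)]
  exact (Fintype.sum_equiv (Fin.insertNthEquiv (fun _ => Fin 2) i) _ _ fun p => rfl).symm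

/-- In each summand of `rawDown_wt` the alternating pair is fixed because `det g = 1`, and the other
factors are transformed by hypothesis. -/
theorem IsImage.rawDown {k : ℕ} {g : Matrix.SpecialLinearGroup (Fin 2) ℂ} {φ ψ : ℕ → ℂ}
    (h : IsImage k g φ ψ) (b : Fin 2) :
    IsImage (k + 1) g (∑ a, g b a • SchurWeyl.rawDown (k + 1) a φ)
      (SchurWeyl.rawDown (k + 1) b ψ) := by
  intro x
  simp only [Finset.sum_apply, Pi.smul_apply, smul_eq_mul, rawDown_wt, Finset.mul_sum]
  have h1 : ∀ y : Fin (k + 1) → Fin 2,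
      ∑ a, ∑ i, (∏ j, g (x j) (y j)) * (g b a * (alt (y i) a * φ (wt (i.removeNth y)))) =
      ∑ i, ∑ a, (∏ j, g (x j) (y j)) * (g b a * (alt (y i) a * φ (wt (i.removeNth y)))) :=
    fun y => Finset.sum_comm
  simp only [h1]
  rw [Finset.sum_comm]
  refine Finset.sum_congr rfl fun i _ => ?_
  rw [sum_insertNth i, h (i.removeNth x), Finset.sum_comm, Finset.mul_sum]
  refine Finset.sum_congr rfl fun y _ => ?_
  rw [← sum_mul_alt g (x i) b]
  simp only [Fin.prod_univ_succAbove _ i, Fin.insertNth_apply_same, Fin.insertNth_apply_succAbove,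
    Fin.removeNth_insertNth, Finset.sum_mul, Fin.removeNth]
  refine Finset.sum_congr rfl fun c _ => Finset.sum_congr rfl fun a _ => ?_
  ring

theorem IsImage.down {k : ℕ} {g : Matrix.SpecialLinearGroup (Fin 2) ℂ} {φ ψ : ℕ → ℂ}
    (h : IsImage k g φ ψ) (b : Fin 2) :
    IsImage (k + 1) g (∑ a, g b a • SchurWeyl.down (k + 1) a φ)
      (SchurWeyl.down (k + 1) b ψ) := by
  intro x
  have := h.rawDown b x
  simp only [SchurWeyl.down, LinearMap.smul_apply, Pi.smul_apply, smul_eq_mul, this,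
    Finset.mul_sum, Finset.sum_apply]
  refine Finset.sum_congr rfl fun c _ => Finset.sum_congr rfl fun a _ => ?_
  ring

theorem pathVal_of_isImage {N k : ℕ} {f : Fin N → Fin 2} (hf : IsTableau k f)
    {g : Matrix.SpecialLinearGroup (Fin 2) ℂ} {φ ψ : ℕ → ℂ} (h : IsImage k g φ ψ)
    (x : Fin N → Fin 2) :
    pathVal N k f x ψ = ∑ y : Fin N → Fin 2, (∏ i, g (x i) (y i)) * pathVal N k f y φ := by
  induction N generalizing k φ ψ with
  | zero =>
    rw [isTableau_zero] at hf
    subst hf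
    simpa [wt, pathVal] using h x
  | succ N ih =>
    obtain ⟨f, s, rfl⟩ := exists_eq_extend f
    obtain ⟨x, b, rfl⟩ := exists_eq_extend x
    rw [sum_extend]
    simp only [Fin.prod_univ_castSucc, Fin.snoc_castSucc, Fin.snoc_last]
    by_cases hs : s = 0
    · subst hs
      obtain ⟨k, rfl, hf₀⟩ := isTableau_extend_zero.1 hf
      simp only [pathVal_extend_zero]
      rw [ih hf₀ (h.up b)]
      simp [mul_add, mul_assoc]
    · obtain rfl : s = 1 := by omega
      simp only [pathVal_extend_one]
      rw [ih (isTableau_extend_one.1 hf) (h.down b)]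
      simp [mul_add, mul_assoc]

/-! ### Young's orthogonal form -/

/-- Only the coordinates `j ≤ k` of a symmetric tensor of degree `k` have a meaning; some of the
two-step relations below are available only there. -/
theorem pathVal_congr {N k : ℕ} {f : Fin N → Fin 2} (hf : IsTableau k f) {φ ψ : ℕ → ℂ}
    (h : ∀ j ≤ k, φ j = ψ j) (x : Fin N → Fin 2) : pathVal N k f x φ = pathVal N k f x ψ := by
  induction N generalizing k φ ψ with
  | zero => exact h 0 (Nat.zero_le k)
  | succ N ih =>
    obtain ⟨f, s, rfl⟩ := exists_eq_extend f
    obtain ⟨x, b, rfl⟩ := exists_eq_extend x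
    by_cases hs : s = 0
    · subst hs
      obtain ⟨k, rfl, hf₀⟩ := isTableau_extend_zero.1 hf
      rw [pathVal_extend_zero, pathVal_extend_zero]
      exact ih hf₀ (fun j hj => h _ (by omega)) x
    · obtain rfl : s = 1 := by omega
      rw [pathVal_extend_one, pathVal_extend_one]
      refine ih (isTableau_extend_one.1 hf) (fun j hj => ?_) x
      simp only [down, rawDown, LinearMap.smul_apply, Pi.smul_apply, LinearMap.coe_mk,
        AddHom.coe_mk]
      split_ifs
      · rw [h _ (by omega)]
      -- At `j = k + 1` the factor `(k + 1) - j` removes the coordinate on which nothing is assumed.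
      · rcases hj.lt_or_eq with hj | rfl
        · rw [h _ (by omega)]
        · simp

theorem up_comm (a b : Fin 2) (φ : ℕ → ℂ) : up a (up b φ) = up b (up a φ) := by
  ext j
  simp [up, add_right_comm]

theorem rawDown_comm (k : ℕ) (a b : Fin 2) (φ : ℕ → ℂ) :
    rawDown (k + 1) a (rawDown k b φ) = rawDown (k + 1) b (rawDown k a φ) := by
  have key : ∀ j : ℕ, rawDown (k + 1) 0 (rawDown k 1 φ) j = rawDown (k + 1) 1 (rawDown k 0 φ) j := by
    rintro (_ | j)
    · simp [rawDown]
    · simp [rawDown]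
      ring
  ext j
  fin_cases a <;> fin_cases b
  · rfl
  · exact key j
  · exact (key j).symm
  · rfl

theorem down_comm (k : ℕ) (a b : Fin 2) (φ : ℕ → ℂ) :
    down (k + 1) a (down k b φ) = down (k + 1) b (down k a φ) := by
  simp only [down, LinearMap.smul_apply, map_smul, rawDown_comm k a b]

/-- Young's form for `t₁₂` before normalization: division by `k + 1` gives the diagonal entry `-1/(k
+ 1)`, and the factor `k + 2` becomes the square root in `sqrt_mul_downConst`. -/
theorem up_rawDown_swap (k : ℕ) (a b : Fin 2) (φ : ℕ → ℂ) (j : ℕ) :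
    ((k : ℂ) + 1) * up b (rawDown (k + 1) a φ) j + up a (rawDown (k + 1) b φ) j =
      (k + 2) * rawDown k a (up b φ) j := by
  fin_cases a <;> fin_cases b <;> rcases j with _ | j <;> simp [up, rawDown] <;> ring

theorem rawDown_up_swap (k : ℕ) (a b : Fin 2) (φ : ℕ → ℂ) (j : ℕ) :
    ((k : ℂ) + 1) * rawDown k b (up a φ) j =
      rawDown k a (up b φ) j + k * up a (rawDown (k + 1) b φ) j := by
  fin_cases a <;> fin_cases b <;> rcases j with _ | j <;> simp [up, rawDown] <;> ring

/-- The source of the parameter: the two double steps differ by a multiple of tensoring with the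
singlet. -/
theorem up_rawDown_sub_rawDown_up (k : ℕ) (a b : Fin 2) (φ : ℕ → ℂ) (j : ℕ) :
    up a (rawDown (k + 1) b φ) j - rawDown k a (up b φ) j = (k + 1) * (alt a b * φ j) := by
  fin_cases a <;> fin_cases b <;> rcases j with _ | j <;> simp [up, rawDown, alt] <;> ring

/-! ### Normalizing constants and the matrix entries of Young's form -/

theorem downConst_sq {k : ℕ} : downConst k ^ 2 = ((k : ℝ) * (k + 1))⁻¹ := by
  rw [downConst, inv_pow, Real.sq_sqrt (by positivity)]

theorem downConst_nonneg (k : ℕ) : 0 ≤ downConst k := by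
  unfold downConst; positivity

theorem one_sub_inv_succ_sq (k : ℕ) :
    1 - (((k : ℝ) + 1)⁻¹) ^ 2 = k * (k + 2) / (k + 1) ^ 2 := by
  field_simp
  ring

theorem sqrt_mul_downConst {k : ℕ} (hk : k ≠ 0) :
    √(1 - (((k : ℝ) + 1)⁻¹) ^ 2) * downConst k = downConst (k + 1) * ((k + 2) / (k + 1)) := by
  have hk' : (k : ℝ) ≠ 0 := Nat.cast_ne_zero.2 hk
  rw [← sq_eq_sq₀ (mul_nonneg (Real.sqrt_nonneg _) (downConst_nonneg _))
    (mul_nonneg (downConst_nonneg _) (by positivity)), mul_pow, mul_pow, downConst_sq,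
    downConst_sq, one_sub_inv_succ_sq, Real.sq_sqrt (by positivity)]
  push_cast
  field_simp
  ring

theorem sqrt_mul_downConst_succ {k : ℕ} (hk : k ≠ 0) :
    √(1 - (((k : ℝ) + 1)⁻¹) ^ 2) * downConst (k + 1) = downConst k * (k / (k + 1)) := by
  have hk' : (k : ℝ) ≠ 0 := Nat.cast_ne_zero.2 hk
  rw [← sq_eq_sq₀ (mul_nonneg (Real.sqrt_nonneg _) (downConst_nonneg _))
    (mul_nonneg (downConst_nonneg _) (by positivity)), mul_pow, mul_pow, downConst_sq,
    downConst_sq, one_sub_inv_succ_sq, Real.sq_sqrt (by positivity)]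
  push_cast
  field_simp
  ring

theorem up_down_swap {k : ℕ} (a b : Fin 2) (φ : ℕ → ℂ) {j : ℕ} (hj : j ≤ k) :
    up b (down (k + 1) a φ) j = -((k : ℂ) + 1)⁻¹ * up a (down (k + 1) b φ) j +
      (√(1 - (((k : ℝ) + 1)⁻¹) ^ 2) : ℝ) * down k a (up b φ) j := by
  have h := up_rawDown_swap k a b φ j
  have hk1 : (k : ℂ) + 1 ≠ 0 := Nat.cast_add_one_ne_zero k
  simp only [down, LinearMap.smul_apply, map_smul, Pi.smul_apply, smul_eq_mul]
  rcases eq_or_ne k 0 with rfl | hk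
  · obtain rfl : j = 0 := by omega
    have h0 : rawDown 0 a (up b φ) 0 = 0 := by fin_cases a <;> simp [rawDown]
    rw [h0] at h ⊢
    push_cast at h ⊢
    linear_combination (downConst (0 + 1) : ℂ) * h
  · have hc : (√(1 - (((k : ℝ) + 1)⁻¹) ^ 2) : ℂ) * downConst k =
        downConst (k + 1) * ((k + 2) / (k + 1)) := by
      rw [← Complex.ofReal_mul, sqrt_mul_downConst hk]; push_cast; rfl
    rw [← mul_assoc (_ : ℂ) (downConst k : ℂ), hc]
    field_simp
    linear_combination (downConst (k + 1) : ℂ) * h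

theorem down_up_swap {k : ℕ} (hk : k ≠ 0) (a b : Fin 2) (φ : ℕ → ℂ) (j : ℕ) :
    down k b (up a φ) j = ((k : ℂ) + 1)⁻¹ * down k a (up b φ) j +
      (√(1 - (((k : ℝ) + 1)⁻¹) ^ 2) : ℝ) * up a (down (k + 1) b φ) j := by
  have h := rawDown_up_swap k a b φ j
  have hk1 : (k : ℂ) + 1 ≠ 0 := Nat.cast_add_one_ne_zero k
  simp only [down, LinearMap.smul_apply, map_smul, Pi.smul_apply, smul_eq_mul]
  have hc : (√(1 - (((k : ℝ) + 1)⁻¹) ^ 2) : ℂ) * downConst (k + 1) =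
      downConst k * (k / (k + 1)) := by
    rw [← Complex.ofReal_mul, sqrt_mul_downConst_succ hk]; push_cast; rfl
  rw [← mul_assoc (_ : ℂ) (downConst (k + 1) : ℂ), hc]
  field_simp
  linear_combination (downConst k : ℂ) * h

theorem extend_comp_swap_castSucc {N : ℕ} (f : Fin N → Fin 2) (s : Fin 2) (a b : Fin N) :
    extend f s ∘ Equiv.swap a.castSucc b.castSucc = extend (f ∘ Equiv.swap a b) s := by
  funext j
  refine Fin.lastCases ?_ (fun j => ?_) j
  · rw [Function.comp_apply, Equiv.swap_apply_of_ne_of_ne (Fin.castSucc_lt_last a).ne'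
      (Fin.castSucc_lt_last b).ne']
    simp only [Fin.snoc_last]
  · rw [Function.comp_apply, (Fin.castSucc_injective N).swap_apply]
    simp only [Fin.snoc_castSucc, Function.comp_apply]

theorem extend_extend_comp_swap_last {N : ℕ} (f : Fin N → Fin 2) (s t : Fin 2) :
    extend (extend f s) t ∘ Equiv.swap (Fin.last N).castSucc (Fin.last (N + 1)) =
      extend (extend f t) s := by
  funext j
  refine Fin.lastCases ?_ (fun j => ?_) j
  · rw [Function.comp_apply, Equiv.swap_apply_right]
    simp only [Fin.snoc_castSucc, Fin.snoc_last]
  · refine Fin.lastCases ?_ (fun j => ?_) j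
    · rw [Function.comp_apply, Equiv.swap_apply_left]
      simp only [Fin.snoc_castSucc, Fin.snoc_last]
    · rw [Function.comp_apply, Equiv.swap_apply_of_ne_of_ne
        (fun h => (Fin.castSucc_lt_last j).ne (Fin.castSucc_injective _ h))
        (Fin.castSucc_lt_last _).ne]
      simp only [Fin.snoc_castSucc]

/-- The axial distance from the cell of `b` to the cell of `a`. -/
def axialDist {N : ℕ} (f : Fin N → Fin 2) (a b : Fin N) : ℝ :=
  ((content f b - content f a : ℤ) : ℝ)

theorem axialDist_extend_extend {N k : ℕ} {f : Fin N → Fin 2} (hf : IsTableau k f) (s t : Fin 2) :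
    axialDist (extend (extend f s) t) (Fin.last N).castSucc (Fin.last (N + 1)) =
      if s = t then 1 else if s = 0 then -((k : ℝ) + 1) else (k : ℝ) + 1 := by
  have h := hf.2
  unfold axialDist
  rw [content_extend_last, content_extend_castSucc, content_extend_last, countBelow_extend_last]
  fin_cases s <;> fin_cases t <;> (simp [h]; try ring)

/-- Young's orthogonal form for the transposition of the places `a` and `b`. -/
def OrthogonalForm {N : ℕ} (k : ℕ) (f : Fin N → Fin 2) (a b : Fin N) : Prop :=
  (∀ x φ, pathVal N k f (x ∘ Equiv.swap a b) φ =
    (((axialDist f a b)⁻¹ : ℝ) : ℂ) * pathVal N k f x φ +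
      ((√(1 - ((axialDist f a b)⁻¹) ^ 2) : ℝ) : ℂ) *
        pathVal N k (f ∘ Equiv.swap a b) x φ) ∧
  (IsTableau k (f ∘ Equiv.swap a b) ∨ √(1 - ((axialDist f a b)⁻¹) ^ 2) = 0)

/-- A transposition of earlier places commutes with the last step. The hypothesis is for all `k`
because removing the last cell changes the row difference. -/
theorem orthogonalForm_extend {N k : ℕ} {f : Fin N → Fin 2} {a b : Fin N} {s : Fin 2}
    (hf : IsTableau k (extend f s)) (h : ∀ k, IsTableau k f → OrthogonalForm k f a b) :
    OrthogonalForm k (extend f s) a.castSucc b.castSucc := by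
  have hd : axialDist (extend f s) a.castSucc b.castSucc = axialDist f a b := by
    rw [axialDist, axialDist, content_extend_castSucc, content_extend_castSucc]
  unfold OrthogonalForm
  rw [hd, extend_comp_swap_castSucc]
  by_cases hs : s = 0
  · subst hs
    obtain ⟨k, rfl, hf₀⟩ := isTableau_extend_zero.1 hf
    obtain ⟨h1, h2⟩ := h k hf₀
    refine ⟨fun x φ => ?_, h2.imp_left fun h => isTableau_extend_zero.2 ⟨k, rfl, h⟩⟩
    obtain ⟨x, c, rfl⟩ := exists_eq_extend x
    rw [extend_comp_swap_castSucc]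
    simp only [pathVal_extend_zero, h1]
  · obtain rfl : s = 1 := by omega
    obtain ⟨h1, h2⟩ := h (k + 1) (isTableau_extend_one.1 hf)
    refine ⟨fun x φ => ?_, h2.imp_left fun h => isTableau_extend_one.2 h⟩
    obtain ⟨x, c, rfl⟩ := exists_eq_extend x
    rw [extend_comp_swap_castSucc]
    simp only [pathVal_extend_one, h1]

/-- Two cells in the same row: the steps commute and the distance is `1`. Cells in different rows:
`up_down_swap` and `down_up_swap`, with distances of opposite sign. -/
theorem orthogonalForm_last {N k : ℕ} {f : Fin N → Fin 2} {s t : Fin 2}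
    (hf : IsTableau k (extend (extend f s) t)) :
    OrthogonalForm k (extend (extend f s) t) (Fin.last N).castSucc (Fin.last (N + 1)) := by
  unfold OrthogonalForm
  rw [extend_extend_comp_swap_last]
  by_cases hs : s = 0 <;> by_cases ht : t = 0
  · subst hs ht
    obtain ⟨k, rfl, hf₁⟩ := isTableau_extend_zero.1 hf
    obtain ⟨k, rfl, hf₀⟩ := isTableau_extend_zero.1 hf₁
    rw [axialDist_extend_extend hf₀]
    refine ⟨fun x φ => ?_, Or.inl hf⟩
    obtain ⟨x, b, rfl⟩ := exists_eq_extend x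
    obtain ⟨x, a, rfl⟩ := exists_eq_extend x
    rw [extend_extend_comp_swap_last]
    simp only [pathVal_extend_zero, up_comm a b]
    simp
  · obtain rfl : t = 1 := by omega
    subst hs
    obtain ⟨k', hk', hf₀⟩ := isTableau_extend_zero.1 (isTableau_extend_one.1 hf)
    obtain rfl : k = k' := by omega
    rw [axialDist_extend_extend hf₀, if_neg (by simp), if_pos rfl, inv_neg, neg_sq]
    refine ⟨fun x φ => ?_, ?_⟩
    · obtain ⟨x, b, rfl⟩ := exists_eq_extend x
      obtain ⟨x, a, rfl⟩ := exists_eq_extend x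
      rw [extend_extend_comp_swap_last]
      have key := pathVal_congr hf₀ (φ := up b (down (k + 1) a φ))
        (ψ := (-((k : ℂ) + 1)⁻¹) • up a (down (k + 1) b φ) +
          ((√(1 - (((k : ℝ) + 1)⁻¹) ^ 2) : ℝ) : ℂ) • down k a (up b φ))
        (fun j hj => up_down_swap a b φ hj) x
      simp only [pathVal_extend_zero, pathVal_extend_one, key, map_add, map_smul, smul_eq_mul]
      push_cast
      congr 1
      rcases k with _ | k
      · simp
      · rw [pathVal_extend_zero, pathVal_extend_one]
    -- For `k = 0` the exchanged word is no tableau, but the distance is `-1` and its coefficient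
    -- vanishes.
    · rcases k with _ | k
      · right; simp
      · exact Or.inl (isTableau_extend_zero.2 ⟨k, rfl, isTableau_extend_one.2 hf₀⟩)
  · obtain rfl : s = 1 := by omega
    subst ht
    obtain ⟨k, rfl, hf₁⟩ := isTableau_extend_zero.1 hf
    have hf₀ := isTableau_extend_one.1 hf₁
    rw [axialDist_extend_extend hf₀, if_neg (by simp), if_neg (by simp)]
    refine ⟨fun x φ => ?_, Or.inl (isTableau_extend_one.2 (isTableau_extend_zero.2 ⟨_, rfl, hf₀⟩))⟩
    obtain ⟨x, b, rfl⟩ := exists_eq_extend x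
    obtain ⟨x, a, rfl⟩ := exists_eq_extend x
    rw [extend_extend_comp_swap_last]
    have key : down (k + 1) b (up a φ) = ((((k + 1 : ℕ) : ℂ) + 1)⁻¹) • down (k + 1) a (up b φ) +
          ((√(1 - ((((k + 1 : ℕ) : ℝ) + 1)⁻¹) ^ 2) : ℝ) : ℂ) • up a (down (k + 1 + 1) b φ) := by
      ext j
      exact down_up_swap k.succ_ne_zero a b φ j
    simp only [pathVal_extend_zero, pathVal_extend_one, key, map_add, map_smul, smul_eq_mul]
    push_cast
    rfl
  · obtain rfl : s = 1 := by omega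
    obtain rfl : t = 1 := by omega
    have hf₀ := isTableau_extend_one.1 (isTableau_extend_one.1 hf)
    rw [axialDist_extend_extend hf₀]
    refine ⟨fun x φ => ?_, Or.inl hf⟩
    obtain ⟨x, b, rfl⟩ := exists_eq_extend x
    obtain ⟨x, a, rfl⟩ := exists_eq_extend x
    rw [extend_extend_comp_swap_last]
    simp only [pathVal_extend_one, down_comm _ a b]
    simp

theorem orthogonalForm_of_isTableau {N k : ℕ} {f : Fin N → Fin 2} (hf : IsTableau k f) (i : ℕ)
    (hi : i + 1 < N) : OrthogonalForm k f ⟨i, Nat.lt_of_succ_lt hi⟩ ⟨i + 1, hi⟩ := by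
  induction N generalizing k with
  | zero => omega
  | succ N ih =>
    obtain ⟨f, s, rfl⟩ := exists_eq_extend f
    rcases Nat.lt_or_ge (i + 1) N with h | h
    · exact orthogonalForm_extend hf fun k hf₀ => ih hf₀ h
    · obtain rfl : N = i + 1 := by omega
      obtain ⟨f, t, rfl⟩ := exists_eq_extend f
      exact orthogonalForm_last hf

/-! ### The components -/

/-- The coordinates of a symmetric tensor. -/
def coord (k : ℕ) : Tens k →ₗ[ℂ] (ℕ → ℂ) where
  toFun m j := m fun i => if (i : ℕ) < j then 1 else 0
  map_add' _ _ := rfl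
  map_smul' _ _ := rfl

/-- A bijection between the places of the letters `1` extends to a permutation; hence a symmetric
tensor is determined by `coord`. -/
theorem exists_perm_comp_eq {N : ℕ} {x y : Fin N → Fin 2} (h : wt x = wt y) :
    ∃ σ : Equiv.Perm (Fin N), x ∘ σ = y := by
  have hw : ∀ z : Fin N → Fin 2, wt z = Fintype.card {i // z i = 1} := fun z => by
    rw [Fintype.card_subtype, Finset.card_filter, wt]
    refine Finset.sum_congr rfl fun i _ => ?_
    rcases (by omega : z i = 0 ∨ z i = 1) with h | h <;> simp [h]
  rw [hw, hw] at h
  let e : {i // y i = 1} ≃ {i // x i = 1} := Fintype.equivOfCardEq h.symm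
  refine ⟨e.extendSubtype, funext fun i => ?_⟩
  by_cases hi : y i = 1
  · rw [hi]; exact e.extendSubtype_mem i hi
  · have := e.extendSubtype_not_mem i hi
    simp only [Function.comp_apply]
    omega

theorem wt_le {N : ℕ} (x : Fin N → Fin 2) : wt x ≤ N := by
  calc wt x ≤ ∑ _i : Fin N, 1 := Finset.sum_le_sum fun i _ => by omega
    _ = N := by simp

theorem wt_initial {N j : ℕ} (hj : j ≤ N) :
    wt (fun i : Fin N => if (i : ℕ) < j then (1 : Fin 2) else 0) = j := by
  have h : ∀ i : Fin N, (((if (i : ℕ) < j then (1 : Fin 2) else 0 : Fin 2) : ℕ)) =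
      if (i : ℕ) < j then 1 else 0 := fun i => by split_ifs <;> rfl
  simp only [wt, h]
  rw [← Finset.card_filter, Fin.card_filter_val_lt, min_eq_right hj]

theorem apply_eq_coord {k : ℕ} {m : Tens k} (hm : m ∈ symTens k) (x : Fin k → Fin 2) :
    m x = coord k m (wt x) := by
  obtain ⟨σ, hσ⟩ := exists_perm_comp_eq
    (x := fun i : Fin k => if (i : ℕ) < wt x then (1 : Fin 2) else 0) (wt_initial (wt_le x))
  have := congrArg (fun v => v fun i : Fin k => if (i : ℕ) < wt x then (1 : Fin 2) else 0) (hm σ)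
  simp only [permRep, MonoidHom.coe_mk, OneHom.coe_mk, LinearMap.coe_mk, AddHom.coe_mk] at this
  rw [hσ] at this
  exact this

theorem sum_wt (k : ℕ) (F : ℕ → ℂ) :
    ∑ x : Fin k → Fin 2, F (wt x) = ∑ j ∈ Finset.range (k + 1), (k.choose j : ℂ) * F j := by
  induction k generalizing F with
  | zero => simp [wt]
  | succ k ih =>
    rw [sum_extend, sum_choose_succ_mul_eq, ← ih fun j => F j + F (j + 1)]
    simp [wt_extend]

theorem inner_eq_coordInner {k : ℕ} (m m' : symTens k) :
    inner ℂ m m' = coordInner k (coord k m) (coord k m') := by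
  rw [Submodule.coe_inner, PiLp.inner_apply, coordInner,
    ← sum_wt k fun j => starRingEnd ℂ (coord k m j) * coord k m' j]
  refine Finset.sum_congr rfl fun x _ => ?_
  rw [apply_eq_coord m.2, apply_eq_coord m'.2, RCLike.inner_apply, mul_comm]

theorem isImage_coord {k : ℕ} (g : Matrix.SpecialLinearGroup (Fin 2) ℂ) (m : symTens k) :
    IsImage k g (coord k m) (coord k (symAct k g m)) := by
  intro x
  rw [← apply_eq_coord (symAct k g m).2]
  simp only [← apply_eq_coord m.2]
  rfl

/-- The embedding of `M_{k+1}` that corresponds to the tableau `f`. -/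
def pathTens {N : ℕ} (k : ℕ) (f : Fin N → Fin 2) : (ℕ → ℂ) →ₗ[ℂ] Tens N where
  toFun φ := WithLp.toLp 2 fun x => pathVal N k f x φ
  map_add' φ ψ := by ext x; simp
  map_smul' c φ := by ext x; simp

/-- The embedding of `π_λ ⊗ M_{k+1}`. -/
def componentMap (N k : ℕ) : YoungSpace N k →ₗ[ℂ] symTens k →ₗ[ℂ] Tens N :=
  (EuclideanSpace.basisFun (Tableau N k) ℂ).toBasis.constr ℂ fun t =>
    pathTens k t.1 ∘ₗ coord k ∘ₗ (symTens k).subtype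

theorem componentMap_apply {N k : ℕ} (u : YoungSpace N k) (m : symTens k) :
    componentMap N k u m = ∑ t : Tableau N k, u t • pathTens k t.1 (coord k m) := by
  simp [componentMap, Module.Basis.constr_apply_fintype]

theorem inner_pathTens {N k : ℕ} (t t' : Tableau N k) (φ ψ : ℕ → ℂ) :
    inner ℂ (pathTens k t.1 φ) (pathTens k t'.1 ψ) = if t = t' then coordInner k φ ψ else 0 := by
  simp only [Subtype.ext_iff]
  rw [← sum_conj_pathVal_mul_pathVal t.2 t'.2, PiLp.inner_apply]
  refine Finset.sum_congr rfl fun x _ => ?_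
  rw [RCLike.inner_apply, mul_comm]
  rfl

theorem componentMap_single {N k : ℕ} (t : Tableau N k) (m : symTens k) :
    componentMap N k (EuclideanSpace.single t 1) m = pathTens k t.1 (coord k m) := by
  classical
  simp [componentMap_apply]

theorem componentMap_youngVec {N k : ℕ} {f : Fin N → Fin 2} (hf : IsTableau k f) (m : symTens k) :
    componentMap N k (youngVec f) m = pathTens k f (coord k m) := by
  rw [youngVec, dif_pos hf, componentMap_single]

theorem isComponent_componentMap (N k : ℕ) : IsComponent (componentMap N k) where
  isometry u u' m m' := by
    classical
    simp only [componentMap_apply, sum_inner, inner_sum, inner_smul_left, inner_smul_right,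
      inner_pathTens, inner_eq_coordInner]
    rw [PiLp.inner_apply]
    simp [Finset.sum_mul, mul_comm, mul_assoc]
  perm i hi u m := by
    refine LinearMap.congr_fun (f := (componentMap N k).flip m ∘ₗ youngGen i hi)
      (g := permRep N (Equiv.swap ⟨i, Nat.lt_of_succ_lt hi⟩ ⟨i + 1, hi⟩) ∘ₗ
        (componentMap N k).flip m) ?_ u
    refine (EuclideanSpace.basisFun (Tableau N k) ℂ).toBasis.ext fun t => ?_
    obtain ⟨h1, h2⟩ := orthogonalForm_of_isTableau t.2 i hi
    simp only [LinearMap.comp_apply, LinearMap.flip_apply, youngGen, Module.Basis.constr_basis]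
    rw [map_add, map_smul, map_smul, LinearMap.add_apply, LinearMap.smul_apply,
      LinearMap.smul_apply, componentMap_youngVec t.2]
    rw [OrthonormalBasis.coe_toBasis, EuclideanSpace.basisFun_apply, componentMap_single]
    ext x
    refine Eq.trans ?_ (h1 x (coord k m)).symm
    rw [PiLp.add_apply]
    refine congrArg₂ (· + ·) rfl ?_
    -- Off the shape `youngVec` is `0` while `pathVal` need not be; there the coefficient is `0`.
    rcases h2 with h2 | h2
    · rw [componentMap_youngVec h2]; rfl
    · rw [h2]
      refine Eq.trans (b := 0) ?_ (by simp)
      unfold axialDist at h2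
      rw [h2]; simp
  sl g u m := by
    rw [componentMap_apply, componentMap_apply, map_sum]
    refine Finset.sum_congr rfl fun t _ => ?_
    rw [map_smul]
    congr 1
    ext x
    exact pathVal_of_isImage t.2 (isImage_coord g m) x

/-! ## The parameters of the tensor embedding -/

theorem tmul_extend {N : ℕ} (u : Tens N) (w : Tens 2) (x : Fin N → Fin 2) (a b : Fin 2) :
    tmul u w (extend (extend x a) b) = u x * w ![a, b] := by
  refine congrArg₂ (· * ·) (congrArg u ?_) (congrArg w ?_)
  · funext i
    change extend (extend x a) b i.castSucc.castSucc = x i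
    simp only [Fin.snoc_castSucc]
  · funext i
    fin_cases i
    · change extend (extend x a) b (Fin.last N).castSucc = a
      simp only [Fin.snoc_castSucc, Fin.snoc_last]
    · change extend (extend x a) b (Fin.last (N + 1)) = b
      simp only [Fin.snoc_last]

theorem permRep_swap_tmul_singlet {N : ℕ} (u : Tens N) :
    permRep (N + 2) (Equiv.swap (Fin.last N).castSucc (Fin.last (N + 1))) (tmul u singlet) =
      -tmul u singlet := by
  ext x
  obtain ⟨x, b, rfl⟩ := exists_eq_extend x
  obtain ⟨x, a, rfl⟩ := exists_eq_extend x
  change tmul u singlet (extend (extend x a) b ∘ _) = -tmul u singlet (extend (extend x a) b)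
  rw [extend_extend_comp_swap_last, tmul_extend, tmul_extend, ← mul_neg]
  congr 1
  rw [singlet_apply, singlet_apply]
  fin_cases a <;> fin_cases b <;> simp

/-- The absolute value of the coordinate of the singlet parameter at `t₂₁`. -/
def coeffP (k : ℕ) : ℝ := √(((k : ℝ) + 1 - 1) / (2 * ((k : ℝ) + 1)))

/-- The coordinate of the singlet parameter at `t₁₂`. -/
def coeffQ (k : ℕ) : ℝ := √(((k : ℝ) + 1 + 1) / (2 * ((k : ℝ) + 1)))

theorem coeffP_sq (k : ℕ) : coeffP k ^ 2 = ((k : ℝ) + 1 - 1) / (2 * ((k : ℝ) + 1)) :=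
  Real.sq_sqrt (div_nonneg (by simp) (by positivity))

theorem coeffQ_sq (k : ℕ) : coeffQ k ^ 2 = ((k : ℝ) + 1 + 1) / (2 * ((k : ℝ) + 1)) :=
  Real.sq_sqrt (by positivity)

theorem coeffP_zero : coeffP 0 = 0 := by simp [coeffP]

theorem coeffQ_pos (k : ℕ) : 0 < coeffQ k := Real.sqrt_pos.2 (by positivity)

theorem coeffP_nonneg (k : ℕ) : 0 ≤ coeffP k := Real.sqrt_nonneg _

theorem coeffP_sq_add_coeffQ_sq (k : ℕ) : coeffP k ^ 2 + coeffQ k ^ 2 = 1 := by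
  rw [coeffP_sq, coeffQ_sq]
  field_simp
  ring

/-- With `coeffP_mul_downConst`: both coefficients cancel their normalizations to the same constant,
so that the commutator appears. -/
theorem coeffQ_mul_downConst (k : ℕ) :
    coeffQ k * downConst (k + 1) = 1 / √2 / (k + 1) := by
  rw [← sq_eq_sq₀ (mul_nonneg (coeffQ_pos k).le (downConst_nonneg _)) (by positivity), mul_pow,
    coeffQ_sq, downConst_sq, div_pow, div_pow, Real.sq_sqrt (by norm_num)]
  push_cast
  field_simp

theorem coeffP_mul_downConst {k : ℕ} (hk : k ≠ 0) :
    coeffP k * downConst k = 1 / √2 / (k + 1) := by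
  have hk' : (k : ℝ) ≠ 0 := Nat.cast_ne_zero.2 hk
  rw [← sq_eq_sq₀ (mul_nonneg (coeffP_nonneg k) (downConst_nonneg _)) (by positivity), mul_pow,
    coeffP_sq, downConst_sq, div_pow, div_pow, Real.sq_sqrt (by norm_num)]
  field_simp
  ring

/-- The `t₂₁` coordinate of the equation saying that `(-coeffP, coeffQ)` is an eigenvector of
Young's form for `-1`. -/
theorem sqrt_mul_coeffQ (k : ℕ) :
    √(1 - (((k : ℝ) + 1)⁻¹) ^ 2) * coeffQ k = (((k : ℝ) + 1)⁻¹ + 1) * coeffP k := by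
  rw [← sq_eq_sq₀ (mul_nonneg (Real.sqrt_nonneg _) (coeffQ_pos k).le)
    (mul_nonneg (by positivity) (coeffP_nonneg k)), mul_pow, mul_pow, coeffP_sq, coeffQ_sq,
    one_sub_inv_succ_sq, Real.sq_sqrt (by positivity)]
  field_simp
  ring

theorem singlet_apply_eq_alt (a b : Fin 2) :
    singlet ![a, b] = ((1 / √2 : ℝ) : ℂ) * alt a b := by
  rw [singlet_apply, alt]
  split_ifs <;> simp

theorem coeffQ_up_down_sub {k : ℕ} (a b : Fin 2) (φ : ℕ → ℂ) {j : ℕ} (hj : j ≤ k) :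
    -(coeffP k : ℂ) * down k a (up b φ) j + coeffQ k * up a (down (k + 1) b φ) j =
      singlet ![a, b] * φ j := by
  have h := up_rawDown_sub_rawDown_up k a b φ j
  have hk1 : (k : ℂ) + 1 ≠ 0 := Nat.cast_add_one_ne_zero k
  have hq : (coeffQ k : ℂ) * downConst (k + 1) = ((1 / √2 : ℝ) : ℂ) / (k + 1) := by
    rw [← Complex.ofReal_mul, coeffQ_mul_downConst]; push_cast; rfl
  simp only [down, LinearMap.smul_apply, map_smul, Pi.smul_apply, smul_eq_mul]
  rw [singlet_apply_eq_alt, ← mul_assoc (_ : ℂ) (downConst (k + 1) : ℂ), hq]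
  rcases eq_or_ne k 0 with rfl | hk
  · obtain rfl : j = 0 := by omega
    have h0 : rawDown 0 a (up b φ) 0 = 0 := by fin_cases a <;> simp [rawDown]
    rw [h0] at h ⊢
    push_cast at h ⊢
    linear_combination (1 / (√2 : ℂ)) * h
  · have hp : (coeffP k : ℂ) * downConst k = ((1 / √2 : ℝ) : ℂ) / (k + 1) := by
      rw [← Complex.ofReal_mul, coeffP_mul_downConst hk]; push_cast; rfl
    rw [← mul_assoc (_ : ℂ) (downConst k : ℂ), neg_mul, hp]
    generalize ((1 / √2 : ℝ) : ℂ) = s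
    field_simp
    linear_combination s * h

theorem pathVal_singlet {N k : ℕ} {f : Fin N → Fin 2} (hf : IsTableau k f) (x : Fin N → Fin 2)
    (a b : Fin 2) (φ : ℕ → ℂ) :
    -(coeffP k : ℂ) * pathVal (N + 2) k (extend (extend f 1) 0) (extend (extend x a) b) φ +
      coeffQ k * pathVal (N + 2) k (extend (extend f 0) 1) (extend (extend x a) b) φ =
      pathVal N k f x φ * singlet ![a, b] := by
  have key := pathVal_congr hf (φ := -(coeffP k : ℂ) • down k a (up b φ) +
    (coeffQ k : ℂ) • up a (down (k + 1) b φ)) (ψ := singlet ![a, b] • φ)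
    (fun j hj => coeffQ_up_down_sub a b φ hj) x
  simp only [map_add, map_smul, smul_eq_mul] at key
  rw [mul_comm (pathVal N k f x φ), ← key, pathVal_extend_one, pathVal_extend_zero]
  -- For `k = 0` the value along the nonexistent `t₂₁` is meaningless, but `coeffP 0 = 0`.
  rcases k with _ | k
  · simp [coeffP_zero]
  · rw [pathVal_extend_zero, pathVal_extend_one]

theorem IsComponent.smul {N k : ℕ} {J : YoungSpace N k →ₗ[ℂ] symTens k →ₗ[ℂ] Tens N}
    (hJ : IsComponent J) {c : ℂ} (hc : ‖c‖ = 1) : IsComponent (c • J) where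
  isometry u u' m m' := by
    have h : c * starRingEnd ℂ c = 1 := by
      rw [Complex.mul_conj, Complex.normSq_eq_norm_sq, hc]; simp
    simp only [LinearMap.smul_apply, inner_smul_left, inner_smul_right, hJ.isometry]
    linear_combination (inner ℂ u u' * inner ℂ m m') * h
  perm i hi u m := by simp only [LinearMap.smul_apply, map_smul, hJ.perm]
  sl g u m := by simp only [LinearMap.smul_apply, map_smul, hJ.sl]

theorem tensorEmbedding_componentMap {N k : ℕ} (h : Param) (c : ℂ)
    (hp : h.p = c * ((-coeffP k : ℝ) : ℂ)) (hq : h.q = c * (coeffQ k : ℂ))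
    (u : YoungSpace N k) (m : symTens k) :
    c • tensorEmbedding N (componentMap N k u m) =
      componentMap (N + 2) k (pathEmbedding h u) m := by
  refine LinearMap.congr_fun (f := c • tensorEmbedding N ∘ₗ (componentMap N k).flip m)
    (g := (componentMap (N + 2) k).flip m ∘ₗ pathEmbedding h) ?_ u
  refine (EuclideanSpace.basisFun (Tableau N k) ℂ).toBasis.ext fun t => ?_
  simp only [LinearMap.comp_apply, LinearMap.smul_apply, LinearMap.flip_apply, pathEmbedding,
    Module.Basis.constr_basis]
  rw [OrthonormalBasis.coe_toBasis, EuclideanSpace.basisFun_apply, componentMap_single, map_add,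
    map_smul, map_smul, LinearMap.add_apply, LinearMap.smul_apply, LinearMap.smul_apply,
    componentMap_youngVec (isTableau_extend_one.2 (isTableau_extend_zero.2 ⟨k, rfl, t.2⟩)), hp, hq]
  have h1 : (c * ((-coeffP k : ℝ) : ℂ)) •
      componentMap (N + 2) k (youngVec (extend (extend t.1 1) 0)) m =
      (c * ((-coeffP k : ℝ) : ℂ)) • pathTens k (extend (extend t.1 1) 0) (coord k m) := by
    rcases k with _ | k
    · simp [coeffP_zero]
    · rw [componentMap_youngVec (isTableau_extend_zero.2 ⟨k, rfl, isTableau_extend_one.2 t.2⟩)]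
  refine Eq.trans ?_ (congrArg (· + _) h1.symm)
  ext x
  obtain ⟨x, b, rfl⟩ := exists_eq_extend x
  obtain ⟨x, a, rfl⟩ := exists_eq_extend x
  have key := pathVal_singlet t.2 x a b (coord k m)
  rw [PiLp.add_apply, PiLp.smul_apply, PiLp.smul_apply, PiLp.smul_apply]
  have h2 := tmul_extend (pathTens k t.1 (coord k m)) singlet x a b
  change c • tmul (pathTens k t.1 (coord k m)) singlet (extend (extend x a) b) =
    (c * ((-coeffP k : ℝ) : ℂ)) •
      pathVal (N + 2) k (extend (extend t.1 1) 0) (extend (extend x a) b) (coord k m) +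
    (c * (coeffQ k : ℂ)) •
      pathVal (N + 2) k (extend (extend t.1 0) 1) (extend (extend x a) b) (coord k m)
  rw [h2]
  change c • (pathVal N k t.1 x (coord k m) * _) = _
  rw [← key]
  simp only [smul_eq_mul]
  push_cast
  ring

/-- The common phase of the parameter is absorbed into `J'`. -/
theorem hasParam_of_eq {N k : ℕ} (h : Param) {c : ℂ} (hc : ‖c‖ = 1)
    (hp : h.p = c * ((-coeffP k : ℝ) : ℂ)) (hq : h.q = c * (coeffQ k : ℂ)) :
    HasParam (tensorEmbedding N) k h := by
  have hc0 : c ≠ 0 := by rw [← norm_ne_zero_iff, hc]; exact one_ne_zero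
  refine ⟨componentMap N k, c⁻¹ • componentMap (N + 2) k, isComponent_componentMap N k,
    (isComponent_componentMap (N + 2) k).smul (by rw [norm_inv, hc, inv_one]), fun u m => ?_⟩
  rw [LinearMap.smul_apply, LinearMap.smul_apply, ← tensorEmbedding_componentMap h c hp hq,
    inv_smul_smul₀ hc0]

/-! ### Uniqueness of the parameter -/

theorem youngGen_youngVec {N k : ℕ} {f : Fin N → Fin 2} (hf : IsTableau k f) (i : ℕ)
    (hi : i + 1 < N) :
    youngGen (k := k) i hi (youngVec f) =
      (((axialDist f ⟨i, Nat.lt_of_succ_lt hi⟩ ⟨i + 1, hi⟩)⁻¹ : ℝ) : ℂ) • youngVec f +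
        ((√(1 - ((axialDist f ⟨i, Nat.lt_of_succ_lt hi⟩ ⟨i + 1, hi⟩)⁻¹) ^ 2) : ℝ) : ℂ) •
          youngVec (f ∘ Equiv.swap ⟨i, Nat.lt_of_succ_lt hi⟩ ⟨i + 1, hi⟩) := by
  have h : (youngVec f : YoungSpace N k) =
      (EuclideanSpace.basisFun (Tableau N k) ℂ).toBasis ⟨f, hf⟩ := by
    rw [OrthonormalBasis.coe_toBasis, EuclideanSpace.basisFun_apply, youngVec, dif_pos hf]
  conv_lhs => rw [h, youngGen, Module.Basis.constr_basis]
  rfl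

theorem pathEmbedding_youngVec {N k : ℕ} {f : Fin N → Fin 2} (hf : IsTableau k f) (h : Param) :
    pathEmbedding (k := k) h (youngVec f) =
      h.p • youngVec (extend (extend f 1) 0) + h.q • youngVec (extend (extend f 0) 1) := by
  have h' : (youngVec f : YoungSpace N k) =
      (EuclideanSpace.basisFun (Tableau N k) ℂ).toBasis ⟨f, hf⟩ := by
    rw [OrthonormalBasis.coe_toBasis, EuclideanSpace.basisFun_apply, youngVec, dif_pos hf]
  rw [h', pathEmbedding, Module.Basis.constr_basis]

theorem exists_symTens_inner_self_eq_one (k : ℕ) : ∃ m : symTens k, inner ℂ m m = (1 : ℂ) := by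
  classical
  refine ⟨⟨EuclideanSpace.single 0 1, fun σ => ?_⟩, ?_⟩
  · ext x
    have h : x ∘ σ = 0 ↔ x = 0 :=
      ⟨fun h => funext fun i => by simpa using congrFun h (σ.symm i), fun h => by subst h; rfl⟩
    simp [permRep, h]
  · rw [Submodule.coe_inner]
    simp

theorem eq_of_hasParam {N k : ℕ} {f : Fin N → Fin 2} (hf : IsTableau k f) {h : Param}
    (hh : HasParam (tensorEmbedding N) k h) :
    ∃ c : ℂ, ‖c‖ = 1 ∧ h.p = c * ((-coeffP k : ℝ) : ℂ) ∧ h.q = c * (coeffQ k : ℂ) := by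
  obtain ⟨J, J', hJ, hJ', hι⟩ := hh
  obtain ⟨m, hm⟩ := exists_symTens_inner_self_eq_one k
  have hJ'inner : ∀ w, inner ℂ (J' w m) (J' w m) = inner ℂ w w := fun w => by
    rw [hJ'.isometry, hm, mul_one]
  have hι' : tmul (J (youngVec f) m) singlet = J' (pathEmbedding h (youngVec f)) m := hι _ m
  have hq0 : (coeffQ k : ℂ) ≠ 0 := by exact_mod_cast (coeffQ_pos k).ne'
  have ht12 : IsTableau k (extend (extend f 0) 1) :=
    isTableau_extend_one.2 (isTableau_extend_zero.2 ⟨k, rfl, hf⟩)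
  -- Proportionality suffices: both vectors have norm `1`, so `‖h.q‖ = coeffQ k` and the ratio is a
  -- phase.
  suffices hpq : h.p * (coeffQ k : ℂ) = -(h.q * (coeffP k : ℂ)) by
    have hn : ‖h.p‖ * coeffQ k = ‖h.q‖ * coeffP k := by
      have := congrArg norm hpq
      simpa [abs_of_pos (coeffQ_pos k), abs_of_nonneg (coeffP_nonneg k)] using this
    have hn2 : ‖h.q‖ = coeffQ k := by
      rw [← sq_eq_sq₀ (norm_nonneg _) (coeffQ_pos k).le]
      linear_combination (‖h.p‖ * coeffQ k + ‖h.q‖ * coeffP k) * (-hn) +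
        coeffQ k ^ 2 * h.unit - ‖h.q‖ ^ 2 * coeffP_sq_add_coeffQ_sq k
    refine ⟨h.q / coeffQ k, ?_, ?_, ?_⟩
    · rw [norm_div, hn2, Complex.norm_real, Real.norm_of_nonneg (coeffQ_pos k).le,
        div_self (coeffQ_pos k).ne']
    · push_cast
      field_simp
      linear_combination hpq
    · field_simp
  rcases k with _ | k
  -- For `k = 0` the image of a tableau is `q` times a unit vector, and all maps involved preserve
  -- norms.
  · have hnorm : ‖h.q‖ ^ 2 = 1 := by
      have h1 : ‖tmul (J (youngVec f) m) singlet‖ = ‖J (youngVec f) m‖ := by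
        rw [norm_tmul, norm_singlet, mul_one]
      have h2 : (inner ℂ (J (youngVec f) m) (J (youngVec f) m) : ℂ) = 1 := by
        rw [hJ.isometry, hm, youngVec, dif_pos hf]; simp
      have h3 := hJ'inner (pathEmbedding h (youngVec f))
      have ht21 : ¬ IsTableau 0 (extend (extend f 1) 0) := fun ht => by
        obtain ⟨k, hk, -⟩ := isTableau_extend_zero.1 ht
        omega
      rw [← hι', inner_self_eq_norm_sq_to_K, h1, ← inner_self_eq_norm_sq_to_K (𝕜 := ℂ), h2,
        pathEmbedding_youngVec hf, youngVec, dif_neg ht21, youngVec, dif_pos ht12, smul_zero,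
        zero_add, inner_self_eq_norm_sq_to_K, norm_smul] at h3
      simp at h3
      exact_mod_cast h3.symm
    have hp : h.p = 0 := by
      have := h.unit
      rw [hnorm] at this
      simpa using this
    simp [hp, coeffP_zero]
  · have ht21 : IsTableau (k + 1) (extend (extend f 1) 0) :=
      isTableau_extend_zero.2 ⟨k, rfl, isTableau_extend_one.2 hf⟩
    have hN : N + 1 < N + 2 := Nat.lt_succ_self _
    have hJn := (hJ'.perm N hN (pathEmbedding h (youngVec f)) m).trans
      ((congrArg _ hι'.symm).trans (permRep_swap_tmul_singlet _))
    -- `J'` is isometric in its first argument at the unit vector `m`, so the eigenvalue `-1` passes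
    -- from the tensors to the Young space.
    have hz : youngGen (k := k + 1) N hN (pathEmbedding h (youngVec f)) +
        pathEmbedding h (youngVec f) = 0 := by
      have h0 := hJ'inner (youngGen N hN (pathEmbedding h (youngVec f)) +
        pathEmbedding h (youngVec f))
      rw [map_add, LinearMap.add_apply, hJn, ← hι', neg_add_cancel, inner_zero_left] at h0
      exact inner_self_eq_zero.1 h0.symm
    have hd21 := axialDist_extend_extend hf 1 0
    have hd12 := axialDist_extend_extend hf 0 1
    have hg21 := youngGen_youngVec ht21 N hN
    have hg12 := youngGen_youngVec ht12 N hN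
    change youngGen N _ _ = (((axialDist _ (Fin.last N).castSucc (Fin.last (N + 1)))⁻¹ : ℝ) : ℂ) •
      _ + ((√(1 - ((axialDist _ (Fin.last N).castSucc (Fin.last (N + 1)))⁻¹) ^ 2) : ℝ) : ℂ) •
      youngVec (_ ∘ Equiv.swap (Fin.last N).castSucc (Fin.last (N + 1))) at hg21 hg12
    rw [hd21, if_neg (by simp), if_neg (by simp), extend_extend_comp_swap_last] at hg21
    rw [hd12, if_neg (by simp), if_pos rfl, extend_extend_comp_swap_last, inv_neg, neg_sq] at hg12
    rw [pathEmbedding_youngVec hf, map_add, map_smul, map_smul, hg21, hg12] at hz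
    have hne : extend (extend f 0) 1 ≠ extend (extend f 1) 0 := fun e => by
      simpa using (extend_inj.1 e).2
    -- The coordinate at `t t₂₁` gives one linear equation between `p` and `q`, which determines
    -- their ratio.
    have hz' := congrArg (fun v => v (⟨_, ht21⟩ : Tableau (N + 2) (k + 1))) hz
    rw [youngVec, dif_pos ht21, youngVec, dif_pos ht12] at hz'
    simp [hne.symm] at hz'
    have hs : (√(1 - ((((k + 1 : ℕ) : ℝ) + 1)⁻¹) ^ 2) : ℂ) * coeffQ (k + 1) =
        ((((k + 1 : ℕ) : ℂ) + 1)⁻¹ + 1) * coeffP (k + 1) := by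
      rw [← Complex.ofReal_mul, sqrt_mul_coeffQ]; push_cast; rfl
    have hr : (((k + 1 : ℕ) : ℂ) + 1)⁻¹ + 1 ≠ 0 := by
      have : (((k + 1 : ℕ) : ℝ) + 1)⁻¹ + 1 ≠ 0 := by positivity
      have := Complex.ofReal_ne_zero.2 this
      push_cast at this ⊢
      exact this
    refine mul_left_cancel₀ hr ?_
    rw [inv_pow] at hs
    push_cast at hs ⊢
    linear_combination (coeffQ (k + 1) : ℂ) * hz' - h.q * hs

theorem hasParam_tensorEmbedding_iff {k n : ℕ} (h : Param) :
    HasParam (tensorEmbedding (k + 2 * n)) k h ↔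
      ∃ c : ℂ, ‖c‖ = 1 ∧ h.p = c * ((-coeffP k : ℝ) : ℂ) ∧ h.q = c * (coeffQ k : ℂ) := by
  constructor
  · obtain ⟨f, hf⟩ := exists_isTableau k n
    exact eq_of_hasParam hf
  · rintro ⟨c, hc, hp, hq⟩
    exact hasParam_of_eq h hc hp hq

theorem norm_sq_of_hasParam {k n : ℕ} {h : Param}
    (hh : HasParam (tensorEmbedding (k + 2 * n)) k h) :
    ‖h.p‖ ^ 2 = ((k : ℝ) + 1 - 1) / (2 * ((k : ℝ) + 1)) ∧
      ‖h.q‖ ^ 2 = ((k : ℝ) + 1 + 1) / (2 * ((k : ℝ) + 1)) := by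
  obtain ⟨c, hc, hp, hq⟩ := (hasParam_tensorEmbedding_iff h).1 hh
  rw [hp, hq, norm_mul, norm_mul, hc, one_mul, one_mul, Complex.norm_real, Complex.norm_real,
    Real.norm_eq_abs, Real.norm_eq_abs, sq_abs, sq_abs, neg_sq, coeffP_sq, coeffQ_sq]
  exact ⟨rfl, rfl⟩

/-! ## The random walk -/

theorem stepLaw_singleton (h : Param) (a : Fin 2) :
    stepLaw h {a} = ENNReal.ofReal (if a = 1 then ‖h.p‖ ^ 2 else ‖h.q‖ ^ 2) := by
  fin_cases a <;> simp [stepLaw]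

theorem measurable_walk {N : ℕ} (t : Fin N → Fin 2) : Measurable (walk t) := by
  refine measurable_pi_iff.2 fun i => ?_
  unfold walk
  split_ifs
  · exact measurable_const
  · exact measurable_pi_apply _
  · exact (Measurable.of_discrete (f := fun a : Fin 2 => 1 - a)).comp (measurable_pi_apply _)

/-- The condition on infinite words to be an infinite tableau. -/
def IsInfTableau (τ : ℕ → Fin 2) : Prop :=
  ∀ m : ℕ, ((Finset.range m).filter fun j => τ j = 1).card ≤
    ((Finset.range m).filter fun j => τ j = 0).card

theorem measurableSet_isInfTableau : MeasurableSet {τ | IsInfTableau τ} := by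
  have h : ∀ (a : Fin 2) (m : ℕ),
      Measurable fun τ : ℕ → Fin 2 => ((Finset.range m).filter fun j => τ j = a).card := by
    intro a m
    simp only [Finset.card_filter]
    exact Finset.measurable_sum _ fun j _ =>
      (Measurable.of_discrete (f := fun b : Fin 2 => if b = a then 1 else 0)).comp
        (measurable_pi_apply j)
  simp only [IsInfTableau, Set.ofPred_forall]
  exact MeasurableSet.iInter fun m => measurableSet_le (h 1 m) (h 0 m)

theorem card_filter_range_succ (τ : ℕ → Fin 2) (a : Fin 2) (m : ℕ) :
    ((Finset.range (m + 1)).filter fun j => τ j = a).card =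
      ((Finset.range m).filter fun j => τ j = a).card + if τ m = a then 1 else 0 := by
  simp only [Finset.card_filter, Finset.sum_range_succ]

theorem walk_of_lt {N : ℕ} (t : Fin N → Fin 2) (ε : ℕ → Fin 2) {i : ℕ} (hi : i < N) :
    walk t ε i = t ⟨i, hi⟩ := dif_pos hi

theorem walk_even {N : ℕ} (t : Fin N → Fin 2) (ε : ℕ → Fin 2) (l : ℕ) :
    walk t ε (N + 2 * l) = ε l := by
  rw [walk, dif_neg (by omega), if_pos (by omega)]
  congr 1
  omega

theorem walk_odd {N : ℕ} (t : Fin N → Fin 2) (ε : ℕ → Fin 2) (l : ℕ) :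
    walk t ε (N + 2 * l + 1) = 1 - ε l := by
  rw [walk, dif_neg (by omega), if_neg (by omega)]
  congr 2
  omega

theorem card_filter_walk {N : ℕ} (t : Fin N → Fin 2) (ε : ℕ → Fin 2) (a : Fin 2) {m : ℕ}
    (hm : m ≤ N) :
    ((Finset.range m).filter fun j => walk t ε j = a).card = countBelow t a m := by
  have h := Fin.sum_univ_eq_sum_range (fun j => if j < m ∧ walk t ε j = a then 1 else 0) N
  simp only [walk_of_lt t ε (Fin.is_lt _)] at h
  rw [countBelow, Finset.card_filter _ (Finset.univ : Finset (Fin N))]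
  refine Eq.trans ?_ h.symm
  rw [← Finset.card_filter]
  congr 1
  ext j
  simp only [Finset.mem_filter, Finset.mem_range]
  exact ⟨fun h => ⟨by omega, h⟩, fun h => h.2⟩

/-- After each double step the row difference is `k` again, and in between it is `k ± 1`; only a
step `t₂₁` at `k = 0` would leave the tableaux. -/
theorem isInfTableau_walk {N k : ℕ} (t : Tableau N k) {ε : ℕ → Fin 2}
    (h : k ≠ 0 ∨ ∀ m, ε m = 0) : IsInfTableau (walk t.1 ε) := by
  have hl : ∀ l, ((Finset.range (N + 2 * l)).filter fun j => walk t.1 ε j = 0).card =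
      ((Finset.range (N + 2 * l)).filter fun j => walk t.1 ε j = 1).card + k := by
    intro l
    induction l with
    | zero =>
      rw [mul_zero, add_zero, card_filter_walk _ _ _ le_rfl, card_filter_walk _ _ _ le_rfl]
      exact t.2.2
    | succ l ih =>
      rw [mul_add, mul_one, ← add_assoc]
      rw [show N + 2 * l + 2 = N + 2 * l + 1 + 1 from rfl]
      simp only [card_filter_range_succ, walk_even, walk_odd, ih]
      rcases (by omega : ε l = 0 ∨ ε l = 1) with h | h <;> simp [h] <;> omega
  intro m
  rcases Nat.lt_or_ge N m with hm | hm
  · obtain ⟨l, hm | hm⟩ : ∃ l, m = N + 2 * l ∨ m = N + 2 * l + 1 := ⟨(m - N) / 2, by omega⟩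
    · rw [hm, hl]; omega
    · rw [hm, card_filter_range_succ, card_filter_range_succ, hl, walk_even]
      rcases h with h | h
      · split_ifs <;> omega
      · simp [h l]; omega
  · rw [card_filter_walk _ _ _ hm, card_filter_walk _ _ _ hm]
    exact t.2.1 m hm

theorem walk_eq_iff {N : ℕ} (t : Fin N → Fin 2) (ε ε' : ℕ → Fin 2) (M : ℕ) :
    (∀ i < N + 2 * M, walk t ε i = walk t ε' i) ↔ ∀ m < M, ε m = ε' m := by
  constructor
  · intro h m hm
    simpa only [walk_even] using h (N + 2 * m) (by omega)
  · intro h i hi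
    unfold walk
    split_ifs
    · rfl
    · rw [h _ (by omega)]
    · rw [h _ (by omega)]

theorem ae_isInfTableau_walk {N k : ℕ} (t : Tableau N k) (h : ℕ → Param)
    (h0 : k = 0 → ∀ j, (h j).p = 0) :
    ∀ᵐ ε ∂Measure.infinitePi fun m => stepLaw (h m), IsInfTableau (walk t.1 ε) := by
  rcases eq_or_ne k 0 with hk | hk
  · have h1 : ∀ᵐ ε ∂Measure.infinitePi fun m => stepLaw (h m), ∀ m, ε m = 0 := by
      refine ae_all_iff.2 fun m => ?_
      refine (measurePreserving_eval_infinitePi (fun m => stepLaw (h m))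
        m).quasiMeasurePreserving.ae (p := fun a => a = 0) ?_
      have : {a : Fin 2 | ¬ a = 0} = {1} := by ext a; fin_cases a <;> simp
      rw [ae_iff, this, stepLaw_singleton, if_pos rfl, h0 hk m]
      simp
    filter_upwards [h1] with ε hε using isInfTableau_walk t (Or.inr hε)
  · exact Filter.Eventually.of_forall fun ε => isInfTableau_walk t (Or.inl hk)

/-- The walk is almost surely a tableau, so restricting its law to `InfTableau` loses no mass. -/
theorem walkMeasure_preimage {N k : ℕ} (t : Tableau N k) (h : ℕ → Param)
    (h0 : k = 0 → ∀ j, (h j).p = 0) {S : Set (ℕ → Fin 2)} (hS : MeasurableSet S) :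
    walkMeasure h t (Subtype.val ⁻¹' S) =
      Measure.infinitePi (fun m : ℕ => stepLaw (h ((N + 2 * m - k) / 2))) (walk t.1 ⁻¹' S) := by
  refine ((MeasurableEmbedding.subtype_coe measurableSet_isInfTableau).comap_apply _ _).trans ?_
  refine (congrArg _ (Subtype.image_preimage_coe {τ | IsInfTableau τ} S)).trans ?_
  rw [Measure.map_apply (measurable_walk t.1) (measurableSet_isInfTableau.inter hS)]
  refine measure_congr ?_
  filter_upwards [ae_isInfTableau_walk t (fun m => h ((N + 2 * m - k) / 2)) fun hk j => h0 hk _]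
    with ε hε
  exact propext ⟨fun h => h.2, fun h => ⟨hε, h⟩⟩

theorem isProbabilityMeasure_walkMeasure {N k : ℕ} (t : Tableau N k) (h : ℕ → Param)
    (h0 : k = 0 → ∀ j, (h j).p = 0) : IsProbabilityMeasure (walkMeasure h t) := by
  refine ⟨?_⟩
  have := walkMeasure_preimage t h h0 MeasurableSet.univ
  rw [Set.preimage_univ, Set.preimage_univ] at this
  rw [this, measure_univ]

/-- The first `N + 2 * M` cells determine the first `M` double steps and conversely, so the cylinder
is a product event for independent steps. -/
theorem walkMeasure_cylinder {N k : ℕ} (t : Tableau N k) (h : ℕ → Param)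
    (h0 : k = 0 → ∀ j, (h j).p = 0) (M : ℕ) (ε : ℕ → Fin 2) :
    walkMeasure h t {τ | ∀ i < N + 2 * M, τ.1 i = walk t.1 ε i} =
      ∏ m ∈ Finset.range M, stepLaw (h ((N + 2 * m - k) / 2)) {ε m} := by
  have hS : MeasurableSet {τ : ℕ → Fin 2 | ∀ i < N + 2 * M, τ i = walk t.1 ε i} := by
    simp only [Set.ofPred_forall]
    exact MeasurableSet.iInter fun i => MeasurableSet.iInter fun _ =>
      measurable_pi_apply i (measurableSet_singleton _)
  rw [← Measure.infinitePi_pi (fun m : ℕ => stepLaw (h ((N + 2 * m - k) / 2)))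
    (s := Finset.range M) (t := fun m => {ε m}) fun m _ => measurableSet_singleton _]
  refine (walkMeasure_preimage t h h0 hS).trans (congrArg _ ?_)
  ext ε'
  simp [walk_eq_iff, Set.mem_pi]

end SchurWeyl

end

theorem mainTheorem6 :
    -- the tensor embeddings are, up to a phase, the only Schur–Weyl embeddings `v ↦ v ⊗ w`
    (∀ (N : ℕ) (w : SchurWeyl.Tens 2),
      SchurWeyl.IsSchurWeylEmbedding (SchurWeyl.tmulRight N w) ↔
        ∃ c : ℂ, ‖c‖ = 1 ∧ w = c • SchurWeyl.singlet) ∧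
    (∀ N : ℕ, SchurWeyl.IsSchurWeylEmbedding (SchurWeyl.tensorEmbedding N)) ∧
    ∀ (k : ℕ) (r : ℝ), r = (k : ℝ) + 1 →
      -- the parameters, which are defined up to a common phase
      (∀ (n : ℕ) (h : SchurWeyl.Param),
        SchurWeyl.HasParam (SchurWeyl.tensorEmbedding (k + 2 * n)) k h ↔
          ∃ c : ℂ, ‖c‖ = 1 ∧ h.p = c * ((-√((r - 1) / (2 * r)) : ℝ) : ℂ) ∧
            h.q = c * ((√((r + 1) / (2 * r)) : ℝ) : ℂ)) ∧
      -- the parameters normalized by `q ≥ 0`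
      (∀ (n : ℕ) (h : SchurWeyl.Param) (q : ℝ), 0 ≤ q → h.q = (q : ℂ) →
        (SchurWeyl.HasParam (SchurWeyl.tensorEmbedding (k + 2 * n)) k h ↔
          h.p = ((-√((r - 1) / (2 * r)) : ℝ) : ℂ) ∧ q = √((r + 1) / (2 * r)))) ∧
      -- the Bernoulli measures
      (∀ h : ℕ → SchurWeyl.Param,
        (∀ n : ℕ, SchurWeyl.HasParam (SchurWeyl.tensorEmbedding (k + 2 * n)) k (h n)) →
        (∀ j : ℕ, ‖(h j).p‖ ^ 2 = (r - 1) / (2 * r) ∧ ‖(h j).q‖ ^ 2 = (r + 1) / (2 * r)) ∧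
        ∀ (N : ℕ) (t : SchurWeyl.Tableau N k),
          MeasureTheory.IsProbabilityMeasure (SchurWeyl.walkMeasure h t) ∧
          ∀ (M : ℕ) (ε : ℕ → Fin 2),
            SchurWeyl.walkMeasure h t
                {τ | ∀ i < N + 2 * M, τ.1 i = SchurWeyl.walk t.1 ε i} =
              ∏ m ∈ Finset.range M,
                ENNReal.ofReal (if ε m = 1 then (r - 1) / (2 * r) else (r + 1) / (2 * r))) := by
  refine ⟨SchurWeyl.isSchurWeylEmbedding_tmulRight_iff,
    SchurWeyl.isSchurWeylEmbedding_tensorEmbedding, ?_⟩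
  rintro k r rfl
  -- `coeffP` and `coeffQ` keep `k + 1 - 1` and `k + 1 + 1` unsimplified, so they agree
  -- definitionally with the formulas in `r = k + 1`.
  have hiff := fun n h => SchurWeyl.hasParam_tensorEmbedding_iff (k := k) (n := n) h
  refine ⟨hiff, fun n h q hq hhq => ?_, fun h hh => ?_⟩
  · rw [hiff]
    constructor
    · rintro ⟨c, hc, hp, hq'⟩
      -- Comparing absolute values removes the phase; as `coeffQ k` is positive, the phase is then
      -- `1`.
      have hqn : q = SchurWeyl.coeffQ k := by
        have := congrArg norm (hhq.symm.trans hq')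
        rwa [norm_mul, hc, one_mul, Complex.norm_real, Complex.norm_real, Real.norm_of_nonneg hq,
          Real.norm_of_nonneg (SchurWeyl.coeffQ_pos k).le] at this
      have hc1 : c = 1 := by
        have hne : (SchurWeyl.coeffQ k : ℂ) ≠ 0 := by exact_mod_cast (SchurWeyl.coeffQ_pos k).ne'
        refine mul_right_cancel₀ hne ?_
        rw [← hq', hhq, hqn, one_mul]
      exact ⟨by rw [hp, hc1, one_mul]; rfl, hqn⟩
    · rintro ⟨hp, rfl⟩
      exact ⟨1, norm_one, by rw [hp, one_mul]; rfl, by rw [hhq, one_mul]; rfl⟩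
  · have hsq := fun j => SchurWeyl.norm_sq_of_hasParam (hh j)
    have h0 : k = 0 → ∀ j, (h j).p = 0 := by
      rintro rfl j
      simpa using (hsq j).1
    refine ⟨hsq, fun N t => ⟨SchurWeyl.isProbabilityMeasure_walkMeasure t h h0, fun M ε => ?_⟩⟩
    rw [SchurWeyl.walkMeasure_cylinder t h h0]
    refine Finset.prod_congr rfl fun m _ => ?_
    rw [SchurWeyl.stepLaw_singleton, (hsq _).1, (hsq _).2]
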